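/- **Theorem 3.1.** Let $A\in\mathbb R^{\ell\times n}$, $B\in\mathbb R^{\ell\times m}$ with $B$ of full column rank ($n+m+\ell\ge 1$), $b\in\mathbb R^\ell$; let $X\subseteq\mathbb R^n$, $Y\subseteq\mathbb R^m$ be polyhedra, and let $f:\mathbb R^n\to\mathbb R$, $g:\mathbb R^m\to\mathbb R$ be convex functions whose subdifferentials $\partial f,\partial g$ are piecewise linear multifunctions, i.e. their graphs are unions of finitely many polyhedra. Assume that $$\min\{f(x)+g(y)\;:\;Ax+By=b,\ x\in X,\ y\in Y\}$$ has an optimal solution. Let $\alpha\in(0,2)$, $\beta>0$, and let $G\in\mathbb R^{n\times n}$ be symmetric positive definite. Write $u=(x,y,\lambda)\in\mathbb R^{n}\times\mathbb R^m\times\mathbb R^\ell$, $\|v\|_M^2=v^\top Mv$, and let a P-GADMM step $u^k\mapsto u^{k+1}$ be $$\begin{aligned}x^{k+1}&=\operatorname*{argmin}_{x\in X}\ f(x)-x^\top A^\top\lambda^k+\tfrac\beta2\|Ax+By^k-b\|^2+\tfrac12\|x-x^k\|_G^2,\\ y^{k+1}&=\operatorname*{argmin}_{y\in Y}\ g(y)-y^\top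 B^\top\lambda^k+\tfrac\beta2\|\alpha Ax^{k+1}+(1-\alpha)(b-By^k)+By-b\|^2,\\ \lambda^{k+1}&=\lambda^k-\beta\bigl(\alpha Ax^{k+1}+(1-\alpha)(b-By^k)+By^{k+1}-b\bigr).\end{aligned}$$ Let $U^*$ be the set of KKT points, i.e. of $(x,y,\lambda)$ such that $\xi-A^\top\lambda\in-N_X(x)$ and $\zeta-B^\top\lambda\in-N_Y(y)$ for some $\xi\in\partial f(x)$, $\zeta\in\partial g(y)$, and $Ax+By=b$, where $N_X,N_Y$ denote normal cones. Put $$\Gamma_\alpha=\begin{pmatrix}G&0&0\\0&\frac\beta\alpha B^\top B&\frac{1-\alpha}\alpha B^\top\\0&\frac{1-\alpha}\alpha B&\frac1{\alpha\beta}I\end{pmatrix},\qquad \Gamma_0=\begin{pmatrix}G&0&0\\0&\beta\frac{2-\alpha}{\alpha^2}B^\top B&0\\0&0&\frac{2-\alpha}{\beta\alpha^2}I\end{pmatrix}$$ (here $\Gamma_0$ is a separate notation, not the case $\alpha=0$ of $\Gamma_\alpha$), $$e(u,1)=\begin{pmatrix}x-P_X[x-(\partial f(x)-A^\top\lambda)]\\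 y-P_Y[y-(\partial g(y)-B^\top\lambda)]\\ Ax+By-b\end{pmatrix}$$ with Euclidean projections $P_X,P_Y$ (a set-valued map), and $\operatorname{dist}_M(u,S)=\inf_{w\in S}\|u-w\|_M$, where $\operatorname{dist}$ is the Euclidean distance. Then: 1. $U^*\neq\emptyset$, and there is $\sigma>0$, independent of the iterates, such that $\|u-u^+\|_{\Gamma_0}^2\ge\sigma\operatorname{dist}^2(0,e(u^+,1))$ for every P-GADMM step $u\mapsto u^+$. 2. For every bounded set $U\subset\mathbb R^{n+m+\ell}$ there is $\psi>0$ such that $\operatorname{dist}(u,U^*)\le\psi\operatorname{dist}(0,e(u,1))$ for all $u\in U$. 3. Every sequence $(u^k)_{k\ge0}$ generated by P-GADMM from an arbitrary starting point $u^0=(x^0,y^0,\lambda^0)$ is bounded. Moreover, for every $\sigma>0$ as in 1 and every $\psi>0$ as in 2 with $U=\{u^k:k\ge0\}$, $$\operatorname{dist}^2_{\Gamma_\alpha}(u^{k+1},U^*)\le\tau\,\operatorname{dist}^2_{\Gamma_\alpha}(u^k,U^*)\quad\text{for all }k\ge1,\qquad \tau=\frac1{1+\frac{\sigma}{\psi^2\lambda_{\max}(\Gamma_\alpha)}}\in(0,1),$$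 where $\lambda_{\max}$ denotes the largest eigenvalue. -/

import Mathlib

open scoped Matrix

noncomputable section

namespace PGADMM

/-- `ℝⁿ` with its Euclidean norm. -/
abbrev Vec (n : ℕ) : Type := EuclideanSpace ℝ (Fin n)

/-- The space `ℝⁿ × ℝᵐ × ℝˡ` of stacked vectors `u = (x, y, lam)`, with the Euclidean norm of
`ℝ^(n+m+l)`. -/
abbrev Pt (n m l : ℕ) : Type := EuclideanSpace ℝ (Fin n ⊕ (Fin m ⊕ Fin l))

/-- The block `x` of `u = (x, y, lam)`. -/
def xPart {n m l : ℕ} (u : Pt n m l) : Vec n := WithLp.toLp 2 fun i => u (Sum.inl i)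

/-- The block `y` of `u = (x, y, lam)`. -/
def yPart {n m l : ℕ} (u : Pt n m l) : Vec m := WithLp.toLp 2 fun i => u (Sum.inr (Sum.inl i))

/-- The block `lam` of `u = (x, y, lam)`. -/
def lamPart {n m l : ℕ} (u : Pt n m l) : Vec l := WithLp.toLp 2 fun i => u (Sum.inr (Sum.inr i))

/-- The matrix-vector product `M v` between Euclidean spaces. -/
abbrev act {ι κ : Type} [Fintype ι] [Fintype κ] [DecidableEq κ]
    (M : Matrix ι κ ℝ) (v : EuclideanSpace ℝ κ) : EuclideanSpace ℝ ι :=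
  Matrix.toEuclideanLin M v

/-- `‖v‖_M² = vᵀ M v`. -/
def sqNormM {ι : Type} [Fintype ι] [DecidableEq ι]
    (M : Matrix ι ι ℝ) (v : EuclideanSpace ℝ ι) : ℝ :=
  inner ℝ v (act M v)

/-- `‖v‖_M = √(vᵀ M v)`. -/
def normM {ι : Type} [Fintype ι] [DecidableEq ι]
    (M : Matrix ι ι ℝ) (v : EuclideanSpace ℝ ι) : ℝ :=
  Real.sqrt (sqNormM M v)

/-- `dist_M(u, S) = inf {‖u - w‖_M | w ∈ S}`, for nonempty `S`. -/
def distM {ι : Type} [Fintype ι] [DecidableEq ι]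
    (M : Matrix ι ι ℝ) (u : EuclideanSpace ℝ ι) (S : Set (EuclideanSpace ℝ ι)) : ℝ :=
  sInf ((fun w => normM M (u - w)) '' S)

/-- The largest (real) eigenvalue of a symmetric matrix. -/
def lambdaMax {ι : Type} [Fintype ι] [DecidableEq ι] (M : Matrix ι ι ℝ) : ℝ :=
  sSup {μ : ℝ | Module.End.HasEigenvalue (Matrix.toLin' M) μ}

/-- A polyhedron: the solution set of finitely many (weak) linear inequalities. -/
def IsPolyhedron {E : Type} [AddCommGroup E] [Module ℝ E] (S : Set E) : Prop :=
  ∃ (N : ℕ) (c : Fin N → E →ₗ[ℝ] ℝ) (d : Fin N → ℝ), S = {z | ∀ i, c i z ≤ d i}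

/-- A piecewise linear multifunction: its graph is a union of finitely many polyhedra. -/
def IsPiecewiseLinear {E F : Type} [AddCommGroup E] [Module ℝ E] [AddCommGroup F] [Module ℝ F]
    (Φ : E → Set F) : Prop :=
  ∃ (N : ℕ) (S : Fin N → Set (E × F)),
    (∀ i, IsPolyhedron (S i)) ∧ {p : E × F | p.2 ∈ Φ p.1} = ⋃ i, S i

/-- The convex subdifferential `∂f(x)`. -/
def subdiff {n : ℕ} (f : Vec n → ℝ) (x : Vec n) : Set (Vec n) :=
  {ξ | ∀ z, f x + inner ℝ ξ (z - x) ≤ f z}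

/-- The normal cone `N_S(x)`; it is empty when `x ∉ S`. -/
def normalCone {n : ℕ} (S : Set (Vec n)) (x : Vec n) : Set (Vec n) :=
  {v | x ∈ S ∧ ∀ z ∈ S, inner ℝ v (z - x) ≤ 0}

/-- `x` belongs to `argmin {φ(z) | z ∈ S}`. -/
def IsArgmin {n : ℕ} (φ : Vec n → ℝ) (S : Set (Vec n)) (x : Vec n) : Prop :=
  x ∈ S ∧ ∀ z ∈ S, φ x ≤ φ z

/-- `p = P_K(z)`: the point `p` is a Euclidean projection of `z` on `K`. -/
def IsProj {n : ℕ} (K : Set (Vec n)) (z p : Vec n) : Prop :=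
  IsArgmin (fun v => ‖v - z‖) K p

/-- The data of `min {f(x) + g(y) | A x + B y = b, x ∈ X, y ∈ Y}`. -/
structure Problem (n m l : ℕ) where
  f : Vec n → ℝ
  g : Vec m → ℝ
  A : Matrix (Fin l) (Fin n) ℝ
  B : Matrix (Fin l) (Fin m) ℝ
  b : Vec l
  X : Set (Vec n)
  Y : Set (Vec m)

namespace Problem

variable {n m l : ℕ} (P : Problem n m l)

/-- `(x, y)` satisfies all the constraints. -/
def IsFeasible (x : Vec n) (y : Vec m) : Prop :=
  x ∈ P.X ∧ y ∈ P.Y ∧ act P.A x + act P.B y = P.b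

/-- `(x, y)` is an optimal solution. -/
def IsOptimal (x : Vec n) (y : Vec m) : Prop :=
  P.IsFeasible x y ∧ ∀ x' y', P.IsFeasible x' y' → P.f x + P.g y ≤ P.f x' + P.g y'

/-- The set `U*` of KKT points. -/
def kkt : Set (Pt n m l) :=
  {u | (∃ ξ ∈ subdiff P.f (xPart u),
          -(ξ - act P.Aᵀ (lamPart u)) ∈ normalCone P.X (xPart u)) ∧
       (∃ ζ ∈ subdiff P.g (yPart u),
          -(ζ - act P.Bᵀ (lamPart u)) ∈ normalCone P.Y (yPart u)) ∧
       act P.A (xPart u) + act P.B (yPart u) - P.b = 0}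

/-- The set-valued error function `e(u, γ)`, with the blocks
`x - P_X[x - γ (∂f(x) - Aᵀ lam)]`, `y - P_Y[y - γ (∂g(y) - Bᵀ lam)]` and `γ (A x + B y - b)`. -/
def err (u : Pt n m l) (γ : ℝ) : Set (Pt n m l) :=
  {w | (∃ ξ ∈ subdiff P.f (xPart u), ∃ p,
          IsProj P.X (xPart u - γ • (ξ - act P.Aᵀ (lamPart u))) p ∧ xPart w = xPart u - p) ∧
       (∃ ζ ∈ subdiff P.g (yPart u), ∃ q,
          IsProj P.Y (yPart u - γ • (ζ - act P.Bᵀ (lamPart u))) q ∧ yPart w = yPart u - q) ∧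
       lamPart w = γ • (act P.A (xPart u) + act P.B (yPart u) - P.b)}

/-- One step of the scheme: `u' = (x', y', lam')` is produced from `u = (x, y, lam)`. -/
def IsStep (G : Matrix (Fin n) (Fin n) ℝ) (α β : ℝ) (u u' : Pt n m l) : Prop :=
  IsArgmin (fun x => P.f x - inner ℝ x (act P.Aᵀ (lamPart u))
      + β / 2 * ‖act P.A x + act P.B (yPart u) - P.b‖ ^ 2
      + 1 / 2 * normM G (x - xPart u) ^ 2) P.X (xPart u') ∧
  IsArgmin (fun y => P.g y - inner ℝ y (act P.Bᵀ (lamPart u))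
      + β / 2 * ‖α • act P.A (xPart u') + (1 - α) • (P.b - act P.B (yPart u))
          + act P.B y - P.b‖ ^ 2) P.Y (yPart u') ∧
  lamPart u' = lamPart u - β • (α • act P.A (xPart u') + (1 - α) • (P.b - act P.B (yPart u))
      + act P.B (yPart u') - P.b)

/-- `u 0, u 1, u 2, …` is generated by the scheme from the arbitrary starting point `u 0`. -/
def IsPGADMM (G : Matrix (Fin n) (Fin n) ℝ) (α β : ℝ) (u : ℕ → Pt n m l) : Prop :=
  ∀ k, P.IsStep G α β (u k) (u (k + 1))

/-- The matrix `Γ_α`. -/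
def Gam (G : Matrix (Fin n) (Fin n) ℝ) (α β : ℝ) :
    Matrix (Fin n ⊕ (Fin m ⊕ Fin l)) (Fin n ⊕ (Fin m ⊕ Fin l)) ℝ :=
  Matrix.fromBlocks G 0 0
    (Matrix.fromBlocks ((β / α) • (P.Bᵀ * P.B)) (((1 - α) / α) • P.Bᵀ)
      (((1 - α) / α) • P.B) ((1 / (α * β)) • (1 : Matrix (Fin l) (Fin l) ℝ)))

/-- The matrix `Γ₀`. It depends on `α` and is not the value of `Γ_α` at `α = 0`. -/
def Gam0 (G : Matrix (Fin n) (Fin n) ℝ) (α β : ℝ) :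
    Matrix (Fin n ⊕ (Fin m ⊕ Fin l)) (Fin n ⊕ (Fin m ⊕ Fin l)) ℝ :=
  Matrix.fromBlocks G 0 0
    (Matrix.fromBlocks ((β * ((2 - α) / α ^ 2)) • (P.Bᵀ * P.B)) 0
      0 (((2 - α) / (β * α ^ 2)) • (1 : Matrix (Fin l) (Fin l) ℝ)))

/-- The defining property of the constant `σ`:
`‖u - u'‖²_{Γ₀} ≥ σ dist²(0, e(u', 1))` for every step from a point `u` to `u'`. -/
def IsResidualConst (G : Matrix (Fin n) (Fin n) ℝ) (α β σ : ℝ) : Prop :=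
  ∀ u u' : Pt n m l, P.IsStep G α β u u' →
    σ * Metric.infDist 0 (P.err u' 1) ^ 2 ≤ normM (P.Gam0 G α β) (u - u') ^ 2

/-- The defining property of the constant `ψ` of a set `U`:
`dist(u, U*) ≤ ψ dist(0, e(u, 1))` for all `u ∈ U`. -/
def IsErrorBoundConst (U : Set (Pt n m l)) (ψ : ℝ) : Prop :=
  ∀ u ∈ U, Metric.infDist u P.kkt ≤ ψ * Metric.infDist 0 (P.err u 1)

/-- The rate `τ = 1 / (1 + σ / (ψ² λ_max(Γ_α)))`. -/
def rate (G : Matrix (Fin n) (Fin n) ℝ) (α β σ ψ : ℝ) : ℝ :=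
  1 / (1 + σ / (ψ ^ 2 * lambdaMax (P.Gam G α β)))

end Problem

end PGADMM

end

/-!
The convergence rate combines three facts.

*Descent.* The optimality conditions of the two subproblems, written at the new multiplier, and the
monotonicity of `∂f`, `∂g` and the normal cones give, for every KKT point `w`,
`‖u⁺ - w‖²_{Γ_α} + ‖u - u⁺‖²_{Γ₀} ≤ ‖u - w‖²_{Γ_α}` (`Problem.IsStep.sqNormM_sub_kkt_le`), provided
that `⟨lam - lam⁺, B (y - y⁺)⟩ ≥ 0`. This last inequality is again monotonicity, and holds once `u`
is itself the result of a step, which is why the rate starts at `k = 1`. The matrix `Γ_α` is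
positive definite since `|1 - α| < 1` and `B` is injective (`Problem.posDef_Gam`), so the iterates
are bounded.

*Residual.* The `y`-block of the residual vanishes after a step, and the other two are bounded by
the changes of `x`, `B y` and `lam`, because projections are nonexpansive
(`Problem.exists_infDist_err_sq_le`); `Γ₀` controls these changes
(`Problem.exists_isResidualConst`).

*Error bound.* The graph of the residual map is a finite union of polyhedra
(`Problem.isPolyhedralUnion_err`), and its zeros are the KKT points. For one polyhedron the local
error bound is Hoffman's (`IsPolyhedron.hasErrorBound`), and it passes to finite unions. On a
bounded set the local bound is a global one (`Problem.exists_isErrorBoundConst`).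

The polyhedral theory rests on Fourier–Motzkin elimination: projections of polyhedra are polyhedra
(`IsPolyhedron.exists_snd`). Besides Hoffman's bound it gives Farkas' lemma
(`exists_nonneg_combination_of_forall_le`), hence the description of the normal cones of polyhedra,
and Lagrange multipliers without a constraint qualification, hence the existence of KKT points
(`Problem.kkt_nonempty`).
-/

namespace PGADMM

/-! ### Polyhedra and Fourier–Motzkin elimination -/

section Polyhedra

variable {E F : Type} [AddCommGroup E] [Module ℝ E] [AddCommGroup F] [Module ℝ F]

theorem isPolyhedron_of_finite {ι : Type} [Finite ι] (c : ι → E →ₗ[ℝ] ℝ) (d : ι → ℝ) :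
    IsPolyhedron {z | ∀ i, c i z ≤ d i} := by
  obtain ⟨N, ⟨e⟩⟩ := Finite.exists_equiv_fin ι
  refine ⟨N, fun j => c (e.symm j), fun j => d (e.symm j), ?_⟩
  ext z
  simp only [Set.mem_ofPred_eq]
  exact e.symm.forall_congr_right.symm

theorem isPolyhedron_le (c : E →ₗ[ℝ] ℝ) (d : ℝ) : IsPolyhedron {z | c z ≤ d} :=
  ⟨1, fun _ => c, fun _ => d, by ext z; simp⟩

theorem IsPolyhedron.inter {S T : Set E} (hS : IsPolyhedron S) (hT : IsPolyhedron T) :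
    IsPolyhedron (S ∩ T) := by
  obtain ⟨N, c, d, rfl⟩ := hS
  obtain ⟨M, c', d', rfl⟩ := hT
  convert isPolyhedron_of_finite (Sum.elim c c') (Sum.elim d d') using 1
  ext z
  simp

theorem isPolyhedron_empty : IsPolyhedron (∅ : Set E) := by
  convert isPolyhedron_le (0 : E →ₗ[ℝ] ℝ) (-1) using 1
  ext z
  simp

theorem isPolyhedron_iInter {ι : Type} [Finite ι] {S : ι → Set E} (h : ∀ i, IsPolyhedron (S i)) :
    IsPolyhedron (⋂ i, S i) := by
  choose N c d hS using h
  convert isPolyhedron_of_finite (ι := Σ i, Fin (N i)) (fun p => c p.1 p.2) (fun p => d p.1 p.2)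
    using 1
  ext z
  simp [hS, Sigma.forall]

theorem IsPolyhedron.preimage {S : Set E} (hS : IsPolyhedron S) (L : F →ₗ[ℝ] E) (v : E) :
    IsPolyhedron {z | L z + v ∈ S} := by
  obtain ⟨N, c, d, rfl⟩ := hS
  refine ⟨N, fun i => c i ∘ₗ L, fun i => d i - c i v, ?_⟩
  ext z
  simp [le_sub_iff_add_le]

theorem IsPolyhedron.preimage_linear {S : Set E} (hS : IsPolyhedron S) (L : F →ₗ[ℝ] E) :
    IsPolyhedron (L ⁻¹' S) := by
  simpa [Set.preimage] using hS.preimage L 0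

theorem isPolyhedron_eq (c : E →ₗ[ℝ] ℝ) (d : ℝ) : IsPolyhedron {z | c z = d} := by
  convert (isPolyhedron_le c d).inter (isPolyhedron_le (-c) (-d)) using 1
  ext z
  simp [le_antisymm_iff]

theorem IsPolyhedron.singleton_zero [FiniteDimensional ℝ E] : IsPolyhedron ({0} : Set E) := by
  convert isPolyhedron_iInter
    (fun i => isPolyhedron_eq ((Module.finBasis ℝ E).coord i) 0) using 1
  ext z
  simp [← (Module.finBasis ℝ E).forall_coord_eq_zero_iff]

theorem isPolyhedron_linear_eq [FiniteDimensional ℝ F] (L : E →ₗ[ℝ] F) (v : F) :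
    IsPolyhedron {z | L z = v} := by
  convert IsPolyhedron.singleton_zero.preimage L (-v) using 1
  ext z
  simp [add_neg_eq_zero]

theorem IsPolyhedron.convex {S : Set E} (hS : IsPolyhedron S) : Convex ℝ S := by
  obtain ⟨N, c, d, rfl⟩ := hS
  have h : {z | ∀ i, c i z ≤ d i} = ⋂ i, {z | c i z ≤ d i} := by ext z; simp
  rw [h]
  exact convex_iInter fun i => convex_halfSpace_le (c i).isLinear _

theorem exists_between_of_finite {s t : Set ℝ} (hs : s.Finite) (ht : t.Finite)
    (h : ∀ x ∈ s, ∀ y ∈ t, x ≤ y) : ∃ z, (∀ x ∈ s, x ≤ z) ∧ ∀ y ∈ t, z ≤ y := by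
  rcases s.eq_empty_or_nonempty with rfl | hne
  · obtain ⟨z, hz⟩ := ht.bddBelow
    exact ⟨z, by simp, fun y hy => hz hy⟩
  · exact ⟨sSup s, fun x hx => le_csSup hs.bddAbove hx,
      fun y hy => csSup_le hne fun x hx => h x hx y hy⟩

/-- One step of Fourier–Motzkin elimination: every upper bound on the last coordinate is paired
with every lower bound. -/
theorem IsPolyhedron.exists_real {S : Set (E × ℝ)} (hS : IsPolyhedron S) :
    IsPolyhedron {z | ∃ t, (z, t) ∈ S} := by
  obtain ⟨N, c, d, rfl⟩ := hS
  set a : Fin N → E →ₗ[ℝ] ℝ := fun i => c i ∘ₗ LinearMap.inl ℝ E ℝ with ha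
  set b : Fin N → ℝ := fun i => c i (0, 1) with hb
  have hc : ∀ i z t, c i (z, t) = a i z + b i * t := by
    intro i z t
    have h : ((z, t) : E × ℝ) = (z, 0) + t • (0, 1) := by simp
    rw [h, map_add, map_smul]
    simp [a, b, mul_comm]
  convert (isPolyhedron_of_finite (ι := {i // b i = 0}) (fun i => a i) (fun i => d i)).inter
    (isPolyhedron_of_finite (ι := {i // 0 < b i} × {i // b i < 0})
      (fun p => (-b p.2) • a p.1 + b p.1 • a p.2)
      (fun p => (-b p.2) * d p.1 + b p.1 * d p.2)) using 1
  ext z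
  simp only [Set.mem_ofPred_eq, hc, Set.mem_inter_iff, Subtype.forall, Prod.forall,
    LinearMap.add_apply, LinearMap.smul_apply, smul_eq_mul]
  constructor
  · rintro ⟨t, ht⟩
    refine ⟨fun i hi => by simpa [hi] using ht i, fun i hi j hj => ?_⟩
    nlinarith [mul_le_mul_of_nonneg_left (ht i) (neg_nonneg.2 hj.le),
      mul_le_mul_of_nonneg_left (ht j) hi.le]
  · rintro ⟨h0, h⟩
    -- a value of `t` between all lower and all upper bounds
    obtain ⟨t, ht⟩ : ∃ t : ℝ, (∀ j, b j < 0 → (d j - a j z) / b j ≤ t) ∧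
        ∀ i, 0 < b i → t ≤ (d i - a i z) / b i := by
      have key : ∀ j, b j < 0 → ∀ i, 0 < b i → (d j - a j z) / b j ≤ (d i - a i z) / b i := by
        intro j hj i hi
        rw [div_le_iff_of_neg hj, div_mul_eq_mul_div, div_le_iff₀ hi]
        nlinarith [h i hi j hj]
      have fin1 : {x | ∃ j, b j < 0 ∧ (d j - a j z) / b j = x}.Finite :=
        (Set.finite_range fun j => (d j - a j z) / b j).subset
          (by rintro _ ⟨j, -, rfl⟩; exact ⟨j, rfl⟩)
      have fin2 : {x | ∃ i, 0 < b i ∧ (d i - a i z) / b i = x}.Finite :=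
        (Set.finite_range fun j => (d j - a j z) / b j).subset
          (by rintro _ ⟨j, -, rfl⟩; exact ⟨j, rfl⟩)
      obtain ⟨t, h1, h2⟩ := exists_between_of_finite fin1 fin2
        (by rintro _ ⟨j, hj, rfl⟩ _ ⟨i, hi, rfl⟩; exact key j hj i hi)
      exact ⟨t, fun j hj => h1 _ ⟨j, hj, rfl⟩, fun i hi => h2 _ ⟨i, hi, rfl⟩⟩
    refine ⟨t, fun i => ?_⟩
    rcases lt_trichotomy (b i) 0 with hi | hi | hi
    · have := (div_le_iff_of_neg hi).1 (ht.1 i hi)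
      nlinarith
    · simpa [hi] using h0 i hi
    · have := (le_div_iff₀ hi).1 (ht.2 i hi)
      nlinarith

theorem IsPolyhedron.exists_fin {k : ℕ} {S : Set (E × (Fin k → ℝ))} (hS : IsPolyhedron S) :
    IsPolyhedron {z | ∃ t, (z, t) ∈ S} := by
  induction k with
  | zero =>
    convert hS.preimage_linear (LinearMap.inl ℝ E (Fin 0 → ℝ)) using 1
    ext z
    exact ⟨fun ⟨t, ht⟩ => by rwa [Subsingleton.elim t 0] at ht, fun h => ⟨0, h⟩⟩
  | succ k ih =>
    have h := (hS.preimage_linear (LinearMap.prod (LinearMap.fst ℝ E (Fin k → ℝ) ∘ₗ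
      LinearMap.fst ℝ (E × (Fin k → ℝ)) ℝ)
      ((Fin.consLinearEquiv ℝ fun _ : Fin (k + 1) => ℝ).toLinearMap ∘ₗ
        LinearMap.prod (LinearMap.snd ℝ (E × (Fin k → ℝ)) ℝ) (LinearMap.snd ℝ E (Fin k → ℝ) ∘ₗ
          LinearMap.fst ℝ (E × (Fin k → ℝ)) ℝ)))).exists_real
    convert ih h using 1
    ext z
    constructor
    · rintro ⟨t, ht⟩
      refine ⟨Fin.tail t, t 0, ?_⟩
      change (z, Fin.cons (t 0) (Fin.tail t)) ∈ S
      rwa [Fin.cons_self_tail]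
    · rintro ⟨t, r, h⟩
      exact ⟨_, h⟩

/-- The projection of a polyhedron along a finite-dimensional space is a polyhedron. -/
theorem IsPolyhedron.exists_snd [FiniteDimensional ℝ F] {S : Set (E × F)} (hS : IsPolyhedron S) :
    IsPolyhedron {z | ∃ t, (z, t) ∈ S} := by
  have e := (Module.finBasis ℝ F).equivFun
  convert (hS.preimage_linear (LinearMap.prodMap LinearMap.id e.symm.toLinearMap)).exists_fin
    using 1
  ext z
  exact e.symm.surjective.exists

/-! ### Farkas' lemma and Lagrange multipliers -/

/-- Farkas' lemma. The cone generated by the `c i` is a projection of a polyhedron, hence is cut out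
by finitely many functionals on the dual space, that is, by vectors of `E`. -/
theorem exists_nonneg_combination_of_forall_le {ι : Type} [Fintype ι] [FiniteDimensional ℝ E]
    (c : ι → E →ₗ[ℝ] ℝ) (v : E →ₗ[ℝ] ℝ) (h : ∀ z, (∀ i, c i z ≤ 0) → v z ≤ 0) :
    ∃ μ : ι → ℝ, (∀ i, 0 ≤ μ i) ∧ v = ∑ i, μ i • c i := by
  classical
  set D := Module.Dual ℝ E
  let S : Set (D × (ι → ℝ)) := {p | p.1 - ∑ i, p.2 i • c i = 0} ∩ {p | ∀ i, -p.2 i ≤ 0}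
  have hS : IsPolyhedron S := by
    refine .inter ?_ ?_
    · convert isPolyhedron_linear_eq (LinearMap.fst ℝ D (ι → ℝ) -
        Fintype.linearCombination ℝ c ∘ₗ LinearMap.snd ℝ D (ι → ℝ)) 0 using 1
      ext p
      simp [Fintype.linearCombination_apply]
    · exact isPolyhedron_of_finite
        (fun i => -(LinearMap.proj i ∘ₗ LinearMap.snd ℝ D (ι → ℝ))) fun _ => 0
  obtain ⟨N, a, d, had⟩ := hS.exists_snd
  have mem : ∀ w : D, (∃ μ : ι → ℝ, (∀ i, 0 ≤ μ i) ∧ w = ∑ i, μ i • c i) ↔ ∀ j, a j w ≤ d j := by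
    intro w
    have := Set.ext_iff.1 had w
    simp only [S, Set.mem_ofPred_eq, Set.mem_inter_iff, sub_eq_zero, neg_nonpos] at this
    rw [← this]
    exact exists_congr fun μ => and_comm
  rw [mem]
  intro j
  have hd : 0 ≤ d j := by
    simpa using (mem 0).1 ⟨0, by simp, by simp⟩ j
  have hac : ∀ i, a j (c i) ≤ 0 := by
    intro i
    by_contra! hpos
    have hd1 : 0 ≤ (d j + 1) / a j (c i) := by positivity
    have := (mem (((d j + 1) / a j (c i)) • c i)).1
      ⟨Pi.single i ((d j + 1) / a j (c i)), fun k => by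
        by_cases hk : k = i
        · subst hk; simpa using hd1
        · simp [hk], by simp [Pi.single_apply, ite_smul]⟩ j
    rw [map_smul, smul_eq_mul, div_mul_cancel₀ _ hpos.ne'] at this
    linarith
  have := h ((Module.evalEquiv ℝ E).symm (a j)) fun i => by
    simpa [Module.apply_evalEquiv_symm_apply] using hac i
  rw [Module.apply_evalEquiv_symm_apply] at this
  linarith

/-- A functional that attains its maximum over a polyhedron at `p` is a nonnegative combination of
the constraints active at `p`. -/
theorem exists_multipliers {ι : Type} [Fintype ι] [FiniteDimensional ℝ E]
    (c : ι → E →ₗ[ℝ] ℝ) (d : ι → ℝ) (v : E →ₗ[ℝ] ℝ) {p : E} (hp : ∀ i, c i p ≤ d i)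
    (h : ∀ z, (∀ i, c i z ≤ d i) → v z ≤ v p) :
    ∃ μ : ι → ℝ, (∀ i, 0 ≤ μ i) ∧ (∀ i, c i p < d i → μ i = 0) ∧ v = ∑ i, μ i • c i := by
  classical
  obtain ⟨μ, hμ, hv⟩ := exists_nonneg_combination_of_forall_le
    (fun i => if c i p = d i then c i else 0) v (by
      intro z hz
      -- moving from `p` a little in the direction `z` violates no constraint
      have hev : ∀ᶠ t : ℝ in nhdsWithin 0 (Set.Ioi 0), ∀ i, c i (p + t • z) ≤ d i := by
        rw [Filter.eventually_all]
        intro i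
        rcases (hp i).lt_or_eq with hi | hi
        · have hcont : Continuous fun t : ℝ => c i (p + t • z) := by
            simp only [map_add, map_smul]
            fun_prop
          have : ∀ᶠ t : ℝ in nhds 0, c i (p + t • z) < d i :=
            hcont.continuousAt.eventually_lt continuousAt_const (by simpa using hi)
          exact (this.filter_mono nhdsWithin_le_nhds).mono fun t ht => ht.le
        · filter_upwards [self_mem_nhdsWithin] with t ht
          have := mul_nonpos_of_nonneg_of_nonpos (le_of_lt ht) (by simpa [hi] using hz i)
          simp only [map_add, map_smul, smul_eq_mul]
          linarith
      obtain ⟨t, ht, ht0⟩ := (hev.and self_mem_nhdsWithin).exists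
      have := h _ ht
      simp only [map_add, map_smul, smul_eq_mul] at this
      have ht0 : 0 < t := ht0
      by_contra! hpos
      nlinarith [mul_pos ht0 hpos])
  refine ⟨fun i => if c i p = d i then μ i else 0, fun i => ?_, fun i hi => if_neg hi.ne, ?_⟩
  · dsimp only
    split_ifs
    exacts [hμ _, le_rfl]
  · rw [hv]
    refine Finset.sum_congr rfl fun i _ => ?_
    by_cases hi : c i p = d i <;> simp [hi]

/-- Lagrange multipliers for the maximization of a functional over the intersection of a polyhedron
with an affine subspace; no constraint qualification is needed. -/
theorem IsPolyhedron.exists_lagrange_multiplier [FiniteDimensional ℝ E] [FiniteDimensional ℝ F]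
    {S : Set E} (hS : IsPolyhedron S) (L : E →ₗ[ℝ] F) (v : E →ₗ[ℝ] ℝ) {p : E} (hp : p ∈ S)
    (h : ∀ z ∈ S, L z = L p → v z ≤ v p) :
    ∃ w : F →ₗ[ℝ] ℝ, ∀ z ∈ S, v z - w (L z) ≤ v p - w (L p) := by
  obtain ⟨N, c, d, rfl⟩ := hS
  let B := Module.finBasis ℝ F
  let κ := Fin (Module.finrank ℝ F)
  obtain ⟨μ, hμ, hμ0, hv⟩ := exists_multipliers
    (Sum.elim c (Sum.elim (fun k : κ => B.coord k ∘ₗ L) fun k : κ => -(B.coord k ∘ₗ L)))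
    (Sum.elim d (Sum.elim (fun k : κ => B.coord k (L p)) fun k : κ => -(B.coord k (L p)))) v
    (p := p) (by simpa using hp) (by
      intro z hz
      simp only [Sum.forall, Sum.elim_inl, Sum.elim_inr, LinearMap.neg_apply, LinearMap.comp_apply,
        neg_le_neg_iff] at hz
      exact h z hz.1 (B.ext_elem fun k => le_antisymm (hz.2.1 k) (hz.2.2 k)))
  refine ⟨∑ k : κ, (μ (.inr (.inl k)) - μ (.inr (.inr k))) • B.coord k, fun z hz => ?_⟩
  have hvz : ∀ z, v z - (∑ k : κ, (μ (.inr (.inl k)) - μ (.inr (.inr k))) • B.coord k) (L z) =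
      ∑ i, μ (.inl i) * c i z := by
    intro z
    rw [hv]
    simp only [Fintype.sum_sum_type, Sum.elim_inl, Sum.elim_inr, LinearMap.add_apply,
      LinearMap.sum_apply, LinearMap.smul_apply, LinearMap.neg_apply, LinearMap.comp_apply,
      smul_eq_mul, sub_mul, Finset.sum_sub_distrib, mul_neg, Finset.sum_neg_distrib]
    ring
  rw [hvz, hvz]
  refine Finset.sum_le_sum fun i _ => ?_
  rcases (hp i).lt_or_eq with hi | hi
  · simp [hμ0 (.inl i) hi]
  · rw [hi]
    exact mul_le_mul_of_nonneg_left (hz i) (hμ _)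

end Polyhedra

/-! ### Finite unions of polyhedra -/

section SemiPoly

variable {E F : Type} [AddCommGroup E] [Module ℝ E] [AddCommGroup F] [Module ℝ F]

/-- Finite unions of polyhedra, as the smallest class of sets that contains the polyhedra and is
closed under binary unions. -/
inductive IsPolyhedralUnion : Set E → Prop
  | of_isPolyhedron {S : Set E} (hS : IsPolyhedron S) : IsPolyhedralUnion S
  | union {S T : Set E} (hS : IsPolyhedralUnion S) (hT : IsPolyhedralUnion T) :
      IsPolyhedralUnion (S ∪ T)

theorem IsPolyhedralUnion.iUnion {ι : Type} [Finite ι] {S : ι → Set E}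
    (h : ∀ i, IsPolyhedralUnion (S i)) : IsPolyhedralUnion (⋃ i, S i) := by
  have := Fintype.ofFinite ι
  classical
  suffices H : ∀ s : Finset ι, IsPolyhedralUnion (⋃ i ∈ s, S i) by
    simpa using H Finset.univ
  intro s
  induction s using Finset.induction_on with
  | empty => simpa using .of_isPolyhedron isPolyhedron_empty
  | insert a s _ ih =>
    rw [Finset.set_biUnion_insert]
    exact (h a).union ih

theorem IsPolyhedralUnion.inter {S T : Set E} (hS : IsPolyhedralUnion S)
    (hT : IsPolyhedralUnion T) : IsPolyhedralUnion (S ∩ T) := by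
  induction hS with
  | union _ _ ih₁ ih₂ => rw [Set.union_inter_distrib_right]; exact ih₁.union ih₂
  | of_isPolyhedron hS =>
    induction hT with
    | union _ _ ih₁ ih₂ => rw [Set.inter_union_distrib_left]; exact ih₁.union ih₂
    | of_isPolyhedron hT => exact .of_isPolyhedron (hS.inter hT)

theorem IsPolyhedralUnion.preimage {S : Set E} (hS : IsPolyhedralUnion S) (L : F →ₗ[ℝ] E) (v : E) :
    IsPolyhedralUnion {z | L z + v ∈ S} := by
  induction hS with
  | of_isPolyhedron hS => exact .of_isPolyhedron (hS.preimage L v)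
  | union _ _ ih₁ ih₂ => exact ih₁.union ih₂

theorem IsPolyhedralUnion.preimage_linear {S : Set E} (hS : IsPolyhedralUnion S) (L : F →ₗ[ℝ] E) :
    IsPolyhedralUnion (L ⁻¹' S) := by
  simpa [Set.preimage] using hS.preimage L 0

theorem IsPolyhedralUnion.exists_snd [FiniteDimensional ℝ F] {S : Set (E × F)}
    (hS : IsPolyhedralUnion S) : IsPolyhedralUnion {z | ∃ t, (z, t) ∈ S} := by
  induction hS with
  | of_isPolyhedron hS => exact .of_isPolyhedron hS.exists_snd
  | union _ _ ih₁ ih₂ =>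
    convert ih₁.union ih₂ using 1
    ext z
    simp [exists_or]

theorem IsPiecewiseLinear.isPolyhedralUnion {Φ : E → Set F} (h : IsPiecewiseLinear Φ) :
    IsPolyhedralUnion {p : E × F | p.2 ∈ Φ p.1} := by
  obtain ⟨N, S, hS, hΦ⟩ := h
  rw [hΦ]
  exact .iUnion fun i => .of_isPolyhedron (hS i)

/-- The graph of the normal cone of a polyhedron is a finite union of polyhedra: there is one piece
for each set of active constraints, on which the normal cone is generated by their gradients. -/
theorem IsPolyhedron.isPolyhedralUnion_normalCone {n : ℕ} {X : Set (Vec n)} (hX : IsPolyhedron X) :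
    IsPolyhedralUnion {p : Vec n × Vec n | p.2 ∈ normalCone X p.1} := by
  obtain ⟨N, c, d, rfl⟩ := hX
  let V := Vec n × Vec n
  let K : Set (Fin N) → Set (V × (Fin N → ℝ)) := fun I =>
    {q | ∀ i, c i q.1.1 ≤ d i} ∩ {q | ∀ i : I, -c i q.1.1 ≤ -d i} ∩ {q | ∀ i, -q.2 i ≤ 0} ∩
      {q | ∀ i : (Iᶜ : Set (Fin N)), q.2 i ≤ 0} ∩
      {q | innerₗ (Vec n) q.1.2 - ∑ i, q.2 i • c i = 0}
  have hK : ∀ I, IsPolyhedron (K I) := by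
    intro I
    let fst₁ : V × (Fin N → ℝ) →ₗ[ℝ] Vec n := LinearMap.fst ℝ _ _ ∘ₗ LinearMap.fst ℝ _ _
    let snd₁ : V × (Fin N → ℝ) →ₗ[ℝ] Vec n := LinearMap.snd ℝ _ _ ∘ₗ LinearMap.fst ℝ _ _
    let μ : V × (Fin N → ℝ) →ₗ[ℝ] (Fin N → ℝ) := LinearMap.snd ℝ _ _
    refine .inter (.inter (.inter (.inter ?_ ?_) ?_) ?_) ?_
    · exact isPolyhedron_of_finite (fun i => c i ∘ₗ fst₁) d
    · exact isPolyhedron_of_finite (fun i : I => -(c i ∘ₗ fst₁)) fun i => -d i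
    · exact isPolyhedron_of_finite (fun i => -(LinearMap.proj i ∘ₗ μ)) fun _ => 0
    · exact isPolyhedron_of_finite (fun i : (Iᶜ : Set (Fin N)) => LinearMap.proj i.1 ∘ₗ μ)
        fun _ => 0
    · convert isPolyhedron_linear_eq (innerₗ (Vec n) ∘ₗ snd₁ -
        Fintype.linearCombination ℝ c ∘ₗ μ) 0 using 1
      ext q
      simp [Fintype.linearCombination_apply, snd₁, μ]
  convert IsPolyhedralUnion.iUnion fun I => .of_isPolyhedron (hK I).exists_snd using 1
  ext ⟨p, v⟩
  simp only [normalCone, Set.mem_ofPred_eq, Set.mem_iUnion, K, Set.mem_inter_iff, Subtype.forall,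
    neg_le_neg_iff, neg_nonpos, sub_eq_zero, Set.mem_compl_iff]
  constructor
  · rintro ⟨hp, hv⟩
    obtain ⟨μ, hμ, hμ0, hvμ⟩ := exists_multipliers c d (innerₗ (Vec n) v) hp (by
      intro z hz
      have := hv z hz
      rw [inner_sub_right] at this
      simpa using this)
    exact ⟨{i | c i p = d i}, μ, ⟨⟨⟨hp, fun i hi => hi.ge⟩, hμ⟩,
      fun i hi => (hμ0 i (lt_of_le_of_ne (hp i) hi)).le⟩, hvμ⟩
  · rintro ⟨I, μ, ⟨⟨⟨hp, hI⟩, hμ⟩, hμ0⟩, hvμ⟩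
    refine ⟨hp, fun z hz => ?_⟩
    have h := LinearMap.congr_fun hvμ (z - p)
    rw [innerₗ_apply_apply] at h
    rw [h, LinearMap.sum_apply]
    refine Finset.sum_nonpos fun i _ => ?_
    rw [LinearMap.smul_apply, map_sub, smul_eq_mul]
    by_cases hi : i ∈ I
    · exact mul_nonpos_of_nonneg_of_nonpos (hμ i) (by linarith [hI i hi, hz i])
    · rw [le_antisymm (hμ0 i hi) (hμ i), zero_mul]

end SemiPoly

/-! ### Error bounds for polyhedral relations -/

/-- A polyhedron of the real line that avoids the origin keeps away from it. -/
theorem IsPolyhedron.exists_pos_le_of_zero_notMem {T : Set ℝ} (hT : IsPolyhedron T)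
    (h : (0 : ℝ) ∉ T) : ∃ ε > 0, ∀ r ∈ T, ε ≤ |r| := by
  obtain ⟨N, c, d, rfl⟩ := hT
  simp only [Set.mem_ofPred_eq, map_zero, not_forall, not_le] at h
  obtain ⟨i, hi⟩ := h
  refine ⟨-d i / (|c i 1| + 1), by have := neg_pos.2 hi; positivity, fun r hr => ?_⟩
  have h1 := hr i
  have h2 : c i r = r * c i 1 := by
    rw [← smul_eq_mul, ← map_smul]; simp
  rw [div_le_iff₀ (by positivity)]
  have h3 : |r * c i 1| = |r| * |c i 1| := abs_mul _ _
  have h4 := neg_abs_le (r * c i 1)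
  nlinarith [abs_nonneg r]

/-- If a planar polyhedron meets the vertical axis, and only at nonpositive heights, then its height
is at most linear in the distance to that axis. -/
theorem IsPolyhedron.exists_slope_bound {T : Set (ℝ × ℝ)} (hT : IsPolyhedron T) {s₀ : ℝ}
    (h₀ : (0, s₀) ∈ T) (h : ∀ s, (0, s) ∈ T → s ≤ 0) :
    ∃ C : ℝ, 0 ≤ C ∧ ∀ r s, (r, s) ∈ T → s ≤ C * |r| := by
  obtain ⟨N, c, d, rfl⟩ := hT
  obtain ⟨a, b, hc⟩ : ∃ a b : Fin N → ℝ, ∀ i r s, c i (r, s) = a i * r + b i * s := by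
    refine ⟨fun i => c i (1, 0), fun i => c i (0, 1), fun i r s => ?_⟩
    have h : ((r, s) : ℝ × ℝ) = r • (1, 0) + s • (0, 1) := by simp
    rw [h, map_add, map_smul, map_smul]
    simp [mul_comm]
  simp only [Set.mem_ofPred_eq, hc] at h₀ h ⊢
  simp only [mul_zero, zero_add] at h₀ h
  have hs₀ := h s₀ h₀
  obtain ⟨i, hi, hdi⟩ : ∃ i, 0 < b i ∧ d i ≤ 0 := by
    by_contra! hcon
    -- otherwise some point `(0, s)` with `s > 0` satisfies all the constraints
    have hev : ∀ᶠ s : ℝ in nhdsWithin 0 (Set.Ioi 0), ∀ i, b i * s ≤ d i := by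
      rw [Filter.eventually_all]
      intro i
      rcases le_or_gt (b i) 0 with hi | hi
      · filter_upwards [self_mem_nhdsWithin] with s hs
        have hs : 0 < s := hs
        nlinarith [h₀ i]
      · have hcont : Continuous fun s : ℝ => b i * s := by fun_prop
        have : ∀ᶠ s : ℝ in nhds 0, b i * s < d i :=
          hcont.continuousAt.eventually_lt continuousAt_const (by simpa using hcon i hi)
        exact (this.filter_mono nhdsWithin_le_nhds).mono fun t ht => ht.le
    obtain ⟨s, hs, hs0⟩ := (hev.and self_mem_nhdsWithin).exists
    exact absurd (h s hs) (not_le.2 hs0)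
  refine ⟨|a i| / b i, by positivity, fun r s hrs => ?_⟩
  rw [div_mul_eq_mul_div, le_div_iff₀ hi, ← abs_mul]
  linarith [hrs i, neg_abs_le (a i * r)]

section ErrorBound

variable {ι κ : Type} [Fintype ι] [Fintype κ]

theorem norm_le_sqrt_card_mul {x : EuclideanSpace ℝ ι} {t : ℝ} (ht : 0 ≤ t)
    (h : ∀ i, |x i| ≤ t) : ‖x‖ ≤ √(Fintype.card ι) * t := by
  refine abs_le_of_sq_le_sq' ?_ (by positivity) |>.2
  rw [EuclideanSpace.real_norm_sq_eq, mul_pow, Real.sq_sqrt (by positivity)]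
  calc ∑ i, x i ^ 2 ≤ ∑ _i : ι, t ^ 2 :=
        Finset.sum_le_sum fun i _ => sq_le_sq' (abs_le.1 (h i)).1 (abs_le.1 (h i)).2
    _ = _ := by simp

/-- The condition `‖x‖_∞ ≤ t` is polyhedral, for `x` and `t` depending linearly on `z`. -/
theorem isPolyhedron_abs_le {E : Type} [AddCommGroup E] [Module ℝ E]
    (x : E →ₗ[ℝ] EuclideanSpace ℝ ι) (t : E →ₗ[ℝ] ℝ) :
    IsPolyhedron {z | ∀ i, |x z i| ≤ t z} := by
  let pr (i : ι) : EuclideanSpace ℝ ι →ₗ[ℝ] ℝ := (EuclideanSpace.proj i).toLinearMap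
  convert (isPolyhedron_of_finite (fun i => pr i ∘ₗ x - t) fun _ => 0).inter
    (isPolyhedron_of_finite (fun i => -(pr i ∘ₗ x) - t) fun _ => 0) using 1
  ext z
  simp [abs_le, pr, forall_and, and_comm, neg_le]

/-- The relation `S` between points `u` and residuals `w` satisfies a local error bound: a point
with a small residual is within a multiple of that residual of a point with residual `0`. -/
def HasErrorBound (S : Set (EuclideanSpace ℝ ι × EuclideanSpace ℝ κ)) : Prop :=
  ∃ ε > 0, ∃ C ≥ 0, ∀ u w, (u, w) ∈ S → ‖w‖ < ε → ∃ u', (u', 0) ∈ S ∧ ‖u - u'‖ ≤ C * ‖w‖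

/-- Hoffman's error bound. The points at sup-distance at most `t` from the zero set form a
polyhedron `D` in `(u, t)`; each inequality of `D` is violated on `S` at most linearly in the
residual, by the planar case applied to the set of attained (residual, violation) pairs. -/
theorem IsPolyhedron.hasErrorBound {S : Set (EuclideanSpace ℝ ι × EuclideanSpace ℝ κ)}
    (hS : IsPolyhedron S) : HasErrorBound S := by
  let E := EuclideanSpace ℝ ι
  let F := EuclideanSpace ℝ κ
  have hcoord : ∀ (w : F) k, |w k| ≤ ‖w‖ := fun w k => PiLp.norm_apply_le w k
  by_cases hZ : ∃ u, (u, (0 : F)) ∈ S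
  swap
  -- without zeros, the residuals on `S` are bounded below
  · have hT : IsPolyhedron {r : ℝ | ∃ q : E × F, (r, q) ∈
        {z : ℝ × (E × F) | z.2 ∈ S} ∩ {z | ∀ k, |z.2.2 k| ≤ z.1}} :=
      ((hS.preimage_linear (LinearMap.snd ℝ ℝ (E × F))).inter
        (isPolyhedron_abs_le (LinearMap.snd ℝ E F ∘ₗ LinearMap.snd ℝ ℝ (E × F))
          (LinearMap.fst ℝ ℝ (E × F)))).exists_snd
    obtain ⟨ε, hε, h⟩ := hT.exists_pos_le_of_zero_notMem (by
      rintro ⟨⟨u, w⟩, hS', hw⟩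
      have : w = 0 := by
        ext k
        simpa using hw k
      subst this
      exact hZ ⟨u, hS'⟩)
    refine ⟨ε, hε, 0, le_rfl, fun u w huw hw => absurd (h ‖w‖ ⟨(u, w), huw, hcoord w⟩) ?_⟩
    simpa using hw
  obtain ⟨u₀, hu₀⟩ := hZ
  let D : Set (E × ℝ) := {q | ∃ u', (q, u') ∈
    {z : (E × ℝ) × E | (z.2, (0 : F)) ∈ S} ∩ {z | ∀ i, |(z.1.1 - z.2) i| ≤ z.1.2}}
  have hD : IsPolyhedron D := by
    refine IsPolyhedron.exists_snd (.inter ?_ ?_)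
    · exact hS.preimage_linear (LinearMap.inl ℝ E F ∘ₗ LinearMap.snd ℝ (E × ℝ) E)
    · exact isPolyhedron_abs_le (LinearMap.fst ℝ E ℝ ∘ₗ LinearMap.fst ℝ (E × ℝ) E -
        LinearMap.snd ℝ (E × ℝ) E) (LinearMap.snd ℝ E ℝ ∘ₗ LinearMap.fst ℝ (E × ℝ) E)
  have hDlarge : ∀ u : E, ∀ t, ‖u - u₀‖ ≤ t → (u, t) ∈ D := fun u t ht =>
    ⟨u₀, hu₀, fun i => (PiLp.norm_apply_le (u - u₀) i).trans ht⟩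
  obtain ⟨N, c, d, hDeq⟩ := hD
  obtain ⟨a, b, hc⟩ : ∃ (a : Fin N → E →ₗ[ℝ] ℝ) (b : Fin N → ℝ),
      ∀ j u t, c j (u, t) = a j u + b j * t := by
    refine ⟨fun j => c j ∘ₗ LinearMap.inl ℝ E ℝ, fun j => c j (0, 1), fun j u t => ?_⟩
    have h : ((u, t) : E × ℝ) = (u, 0) + t • (0, 1) := by simp
    rw [h, map_add, map_smul]
    simp [mul_comm]
  have hDmem : ∀ u t, (u, t) ∈ D ↔ ∀ j, a j u + b j * t ≤ d j := by
    intro u t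
    rw [hDeq]
    simp only [Set.mem_ofPred_eq, hc]
  have key : ∀ j, ∃ C : ℝ, 0 ≤ C ∧ ∀ u w, (u, w) ∈ S → ∀ t, C * ‖w‖ ≤ t →
      a j u + b j * t ≤ d j := by
    intro j
    have hT : IsPolyhedron {q : ℝ × ℝ | ∃ p : E × F, (q, p) ∈
        {z : (ℝ × ℝ) × (E × F) | z.2 ∈ S} ∩ {z | ∀ k, |z.2.2 k| ≤ z.1.1} ∩
          {z | z.1.2 - a j z.2.1 ≤ -d j}} := by
      refine IsPolyhedron.exists_snd (.inter (.inter ?_ ?_) ?_)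
      · exact hS.preimage_linear (LinearMap.snd ℝ (ℝ × ℝ) (E × F))
      · exact isPolyhedron_abs_le (LinearMap.snd ℝ E F ∘ₗ LinearMap.snd ℝ (ℝ × ℝ) (E × F))
          (LinearMap.fst ℝ ℝ ℝ ∘ₗ LinearMap.fst ℝ (ℝ × ℝ) (E × F))
      · exact isPolyhedron_le (LinearMap.snd ℝ ℝ ℝ ∘ₗ LinearMap.fst ℝ (ℝ × ℝ) (E × F) -
          a j ∘ₗ LinearMap.fst ℝ E F ∘ₗ LinearMap.snd ℝ (ℝ × ℝ) (E × F)) _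
    obtain ⟨C, hC, h⟩ := hT.exists_slope_bound (s₀ := a j u₀ - d j)
      ⟨(u₀, 0), ⟨hu₀, by simp⟩, by simp⟩ (by
        rintro s ⟨⟨u, w⟩, ⟨hS', hw⟩, hs⟩
        have : w = 0 := by
          ext k
          simpa using hw k
        subst this
        have := (hDmem u 0).1 ⟨u, hS', by simp⟩ j
        simp only [Set.mem_ofPred_eq] at hs
        linarith)
    -- `D` is closed under increasing `t`, so its inequalities bound `t` from below
    have hb : b j ≤ 0 := by
      by_contra! hb
      have h0 := (hDmem u₀ (|d j - a j u₀| / b j + 1)).1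
        (hDlarge _ _ (by simp; positivity)) j
      rw [mul_add, mul_div_cancel₀ _ hb.ne'] at h0
      linarith [le_abs_self (d j - a j u₀)]
    rcases hb.lt_or_eq with hb | hb
    · refine ⟨C / -b j, by have := neg_pos.2 hb; positivity, fun u w huw t ht => ?_⟩
      have h1 := h ‖w‖ (a j u - d j) ⟨(u, w), ⟨huw, hcoord w⟩, by simp⟩
      rw [div_mul_eq_mul_div, div_le_iff₀ (neg_pos.2 hb)] at ht
      rw [abs_of_nonneg (norm_nonneg w)] at h1
      linarith
    · refine ⟨0, le_rfl, fun u w huw t _ => ?_⟩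
      have h0 := (hDmem u ‖u - u₀‖).1 (hDlarge _ _ le_rfl) j
      rw [hb, zero_mul] at h0 ⊢
      exact h0
  choose C hC h using key
  have hsum : 0 ≤ ∑ j, C j := Finset.sum_nonneg fun j _ => hC j
  refine ⟨1, one_pos, √(Fintype.card ι) * ∑ j, C j, by positivity, fun u w huw _ => ?_⟩
  obtain ⟨u', hu', hd⟩ := (hDmem u ((∑ j, C j) * ‖w‖)).2 fun j => h j u w huw _
    (mul_le_mul_of_nonneg_right (Finset.single_le_sum (fun j _ => hC j) (Finset.mem_univ j))
      (norm_nonneg w))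
  refine ⟨u', hu', ?_⟩
  rw [mul_assoc]
  exact norm_le_sqrt_card_mul (by positivity) hd

/-- Robinson's theorem: the inverse of a piecewise linear multifunction is locally upper Lipschitz
at the origin. -/
theorem IsPolyhedralUnion.hasErrorBound {S : Set (EuclideanSpace ℝ ι × EuclideanSpace ℝ κ)}
    (hS : IsPolyhedralUnion S) : HasErrorBound S := by
  induction hS with
  | of_isPolyhedron hS => exact hS.hasErrorBound
  | union _ _ ih₁ ih₂ =>
    obtain ⟨ε₁, hε₁, C₁, hC₁, h₁⟩ := ih₁
    obtain ⟨ε₂, hε₂, C₂, hC₂, h₂⟩ := ih₂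
    refine ⟨min ε₁ ε₂, lt_min hε₁ hε₂, max C₁ C₂, le_max_of_le_left hC₁, ?_⟩
    rintro u w (huw | huw) hw
    · obtain ⟨u', hu', hd⟩ := h₁ u w huw (hw.trans_le (min_le_left _ _))
      exact ⟨u', .inl hu', hd.trans (by gcongr; exact le_max_left _ _)⟩
    · obtain ⟨u', hu', hd⟩ := h₂ u w huw (hw.trans_le (min_le_right _ _))
      exact ⟨u', .inr hu', hd.trans (by gcongr; exact le_max_right _ _)⟩

end ErrorBound

/-! ### Subgradients, optimality conditions and projections -/

/-- Optimality condition for a finite convex function on a convex set. The strict epigraph of `F` is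
open, so it can be separated from `C × (-∞, F p]` by a hyperplane that is not vertical. -/
theorem exists_subgradient_nonneg_on {E : Type} [NormedAddCommGroup E] [NormedSpace ℝ E]
    [FiniteDimensional ℝ E] {F : E → ℝ} (hF : ConvexOn ℝ Set.univ F) {C : Set E} (hC : Convex ℝ C)
    {p : E} (hp : p ∈ C) (hmin : ∀ z ∈ C, F p ≤ F z) :
    ∃ φ : E →L[ℝ] ℝ, (∀ z, F p + φ (z - p) ≤ F z) ∧ ∀ z ∈ C, 0 ≤ φ (z - p) := by
  have hcont : Continuous F := hF.locallyLipschitz.continuous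
  have hO : Convex ℝ {q : E × ℝ | F q.1 < q.2} := by
    simpa using hF.convex_strict_epigraph
  have hOo : IsOpen {q : E × ℝ | F q.1 < q.2} :=
    isOpen_lt (hcont.comp continuous_fst) continuous_snd
  have hdisj : Disjoint {q : E × ℝ | F q.1 < q.2} (C ×ˢ Set.Iic (F p)) := by
    rw [Set.disjoint_left]
    rintro ⟨z, t⟩ hz ⟨hzC, ht⟩
    exact absurd (hmin z hzC) (not_le.2 (lt_of_lt_of_le hz ht))
  obtain ⟨L, s, hLO, hLD⟩ := geometric_hahn_banach_open hO hOo (hC.prod (convex_Iic (F p))) hdisj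
  obtain ⟨φ, k, hL⟩ : ∃ (φ : E →L[ℝ] ℝ) (k : ℝ), ∀ z t, L (z, t) = φ z + k * t := by
    refine ⟨L.comp (.inl ℝ E ℝ), L (0, 1), fun z t => ?_⟩
    have h : ((z, t) : E × ℝ) = (z, 0) + t • (0, 1) := by simp
    rw [h, map_add, map_smul]
    simp [mul_comm]
  have hlt : ∀ z t, F z < t → φ z + k * t < s := fun z t h => hL z t ▸ hLO (z, t) h
  have hge : ∀ z ∈ C, s ≤ φ z + k * F p := fun z hz =>
    hL z _ ▸ hLD (z, F p) ⟨hz, Set.mem_Iic.2 le_rfl⟩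
  have hle : ∀ z, φ z + k * F z ≤ s := by
    intro z
    have hc : Continuous fun t : ℝ => φ z + k * t := by fun_prop
    refine le_of_tendsto (hc.continuousWithinAt (s := Set.Ioi (F z)) (x := F z)).tendsto ?_
    filter_upwards [self_mem_nhdsWithin] with t ht
    exact (hlt z t ht).le
  have hk : k < 0 := by linarith [hlt p (F p + 1) (by linarith), hge p hp]
  refine ⟨(-k)⁻¹ • φ, fun z => ?_, fun z hz => ?_⟩
  · have h1 : φ (z - p) ≤ (-k) * (F z - F p) := by
      rw [map_sub]; linarith [hle z, hge p hp]
    have h2 : (-k)⁻¹ * φ (z - p) ≤ F z - F p := by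
      rwa [inv_mul_le_iff₀ (neg_pos.2 hk)]
    simp only [_root_.smul_apply, smul_eq_mul]
    linarith
  · have h1 : 0 ≤ φ (z - p) := by
      rw [map_sub]; linarith [hle p, hge z hz]
    have := neg_pos.2 hk
    simp only [_root_.smul_apply, smul_eq_mul]
    positivity

section Vec

variable {n : ℕ} {f : Vec n → ℝ}

theorem exists_mem_subdiff_of_isArgmin (hf : ConvexOn ℝ Set.univ f) {C : Set (Vec n)}
    (hC : Convex ℝ C) {p : Vec n} (h : IsArgmin f C p) :
    ∃ ξ ∈ subdiff f p, -ξ ∈ normalCone C p := by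
  obtain ⟨φ, h1, h2⟩ := exists_subgradient_nonneg_on hf hC h.1 h.2
  refine ⟨(InnerProductSpace.toDual ℝ (Vec n)).symm φ, fun z => ?_, h.1, fun z hz => ?_⟩
  · simpa using h1 z
  · simpa using h2 z hz

theorem subdiff_nonempty (hf : ConvexOn ℝ Set.univ f) (p : Vec n) : (subdiff f p).Nonempty := by
  obtain ⟨ξ, hξ, -⟩ := exists_mem_subdiff_of_isArgmin hf (convex_singleton p) (p := p)
    ⟨rfl, by simp⟩
  exact ⟨ξ, hξ⟩

theorem inner_sub_nonneg_of_mem_subdiff {x y ξ η : Vec n} (hξ : ξ ∈ subdiff f x)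
    (hη : η ∈ subdiff f y) : 0 ≤ inner ℝ (ξ - η) (x - y) := by
  have h1 := hξ y
  have h2 := hη x
  rw [← neg_sub x y, inner_neg_right] at h1
  rw [inner_sub_left]
  linarith

/-- The necessary condition for a minimizer of `f + q`, where `q` has a second-order expansion at
the minimizer. -/
theorem exists_mem_subdiff_of_isArgmin_add (hf : ConvexOn ℝ Set.univ f) {C : Set (Vec n)}
    (hC : Convex ℝ C) {q : Vec n → ℝ} {p v : Vec n} (K : Vec n → ℝ)
    (hq : ∀ h (t : ℝ), q (p + t • h) = q p + t * inner ℝ v h + t ^ 2 * K h)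
    (h : IsArgmin (fun z => f z + q z) C p) :
    ∃ ξ ∈ subdiff f p, -(ξ + v) ∈ normalCone C p := by
  have hfl : ConvexOn ℝ Set.univ (fun z => f z + inner ℝ v z) :=
    hf.add ((innerₗ (Vec n) v).convexOn convex_univ)
  have hmin : IsArgmin (fun z => f z + inner ℝ v z) C p := by
    refine ⟨h.1, fun z hz => ?_⟩
    have hev : ∀ t ∈ Set.Ioo (0 : ℝ) 1, f p ≤ f z + inner ℝ v (z - p) + t * K (z - p) := by
      rintro t ⟨ht0, ht1⟩
      have hseg : p + t • (z - p) = (1 - t) • p + t • z := by module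
      have h1 := h.2 (p + t • (z - p)) (by
        rw [hseg]; exact hC h.1 hz (by linarith) ht0.le (by ring))
      have h2 := hf.2 (Set.mem_univ p) (Set.mem_univ z) (by linarith : 0 ≤ 1 - t) ht0.le (by ring)
      simp only [hq, smul_eq_mul] at h1 h2
      rw [hseg] at h1
      have h3 : 0 ≤ t * (f z + inner ℝ v (z - p) + t * K (z - p) - f p) := by linarith
      linarith [nonneg_of_mul_nonneg_right h3 ht0]
    have hlim : f p ≤ f z + inner ℝ v (z - p) + 0 * K (z - p) := by
      have hc : Continuous fun t : ℝ => f z + inner ℝ v (z - p) + t * K (z - p) := by fun_prop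
      refine ge_of_tendsto (hc.continuousWithinAt (s := Set.Ioi 0) (x := 0)).tendsto ?_
      filter_upwards [Ioo_mem_nhdsGT (one_pos : (0 : ℝ) < 1)] with t ht using hev t ht
    rw [inner_sub_right] at hlim
    dsimp only
    linarith
  obtain ⟨ξ, hξ, hN⟩ := exists_mem_subdiff_of_isArgmin hfl hC hmin
  refine ⟨ξ - v, fun z => ?_, by simpa using hN⟩
  have := hξ z
  simp only [inner_sub_left, inner_sub_right] at this ⊢
  linarith

theorem isProj_iff_mem_normalCone {K : Set (Vec n)} (hK : Convex ℝ K) {z p : Vec n} :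
    IsProj K z p ↔ z - p ∈ normalCone K p := by
  constructor
  · rintro ⟨hp, h⟩
    refine ⟨hp, ?_⟩
    rw [← norm_eq_iInf_iff_real_inner_le_zero hK hp]
    have : Nonempty K := ⟨⟨p, hp⟩⟩
    refine le_antisymm (le_ciInf fun w => ?_) (ciInf_le ⟨0, ?_⟩ (⟨p, hp⟩ : K))
    · rw [norm_sub_rev z, norm_sub_rev z]; exact h w w.2
    · rintro _ ⟨w, rfl⟩; exact norm_nonneg _
  · rintro ⟨hp, h⟩
    rw [← norm_eq_iInf_iff_real_inner_le_zero hK hp] at h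
    refine ⟨hp, fun w hw => ?_⟩
    dsimp only
    rw [norm_sub_rev p, norm_sub_rev w, h]
    exact ciInf_le ⟨0, by rintro _ ⟨w, rfl⟩; exact norm_nonneg _⟩ (⟨w, hw⟩ : K)

theorem inner_sub_nonneg_of_mem_normalCone {K : Set (Vec n)} {p q v w : Vec n}
    (hv : v ∈ normalCone K p) (hw : w ∈ normalCone K q) : 0 ≤ inner ℝ (v - w) (p - q) := by
  have h1 := hv.2 q hw.1
  have h2 := hw.2 p hv.1
  rw [← neg_sub p q, inner_neg_right] at h1
  rw [inner_sub_left]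
  linarith

theorem exists_isProj {K : Set (Vec n)} (hK : IsPolyhedron K) (hne : K.Nonempty) (z : Vec n) :
    ∃ p, IsProj K z p := by
  have hcl : IsClosed K := by
    obtain ⟨N, c, d, rfl⟩ := hK
    rw [Set.ofPred_forall]
    exact isClosed_iInter fun i =>
      isClosed_le (LinearMap.continuous_of_finiteDimensional _) continuous_const
  obtain ⟨p, hp, h⟩ := exists_norm_eq_iInf_of_complete_convex hne hcl.isComplete hK.convex z
  refine ⟨p, (isProj_iff_mem_normalCone hK.convex).2 ⟨hp, ?_⟩⟩
  exact (norm_eq_iInf_iff_real_inner_le_zero hK.convex hp).1 h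

theorem norm_sub_le_of_isProj {K : Set (Vec n)} (hK : Convex ℝ K) {z w p q : Vec n}
    (hp : IsProj K z p) (hq : IsProj K w q) : ‖p - q‖ ≤ ‖z - w‖ := by
  rw [isProj_iff_mem_normalCone hK] at hp hq
  have h := inner_sub_nonneg_of_mem_normalCone hp hq
  have h1 : z - p - (w - q) = (z - w) - (p - q) := by abel
  rw [h1, inner_sub_left, real_inner_self_eq_norm_sq] at h
  have h2 := real_inner_le_norm (z - w) (p - q)
  by_contra! hlt
  nlinarith [norm_nonneg (z - w), norm_nonneg (p - q)]

end Vec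

/-! ### Existence of KKT points -/

section KKT

variable {n m l : ℕ} (P : Problem n m l)

/-- The stacked vector `(x, y, lam)`. -/
noncomputable def stack (x : Vec n) (y : Vec m) (w : Vec l) : Pt n m l :=
  WithLp.toLp 2 (Sum.elim x (Sum.elim y w))

@[simp] theorem xPart_stack (x : Vec n) (y : Vec m) (w : Vec l) : xPart (stack x y w) = x := rfl
@[simp] theorem yPart_stack (x : Vec n) (y : Vec m) (w : Vec l) : yPart (stack x y w) = y := rfl
@[simp] theorem lamPart_stack (x : Vec n) (y : Vec m) (w : Vec l) : lamPart (stack x y w) = w := rfl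

theorem inner_act_transpose {ι κ : Type} [Fintype ι] [Fintype κ] [DecidableEq ι] [DecidableEq κ]
    (M : Matrix ι κ ℝ) (v : EuclideanSpace ℝ ι) (w : EuclideanSpace ℝ κ) :
    inner ℝ (act Mᵀ v) w = inner ℝ v (act M w) := by
  have h := Matrix.toEuclideanLin_conjTranspose_eq_adjoint M
  rw [Matrix.conjTranspose_eq_transpose_of_trivial] at h
  rw [act, h, LinearMap.adjoint_inner_left]

theorem Problem.kkt_nonempty (hf : ConvexOn ℝ Set.univ P.f) (hg : ConvexOn ℝ Set.univ P.g)
    (hX : IsPolyhedron P.X) (hY : IsPolyhedron P.Y) (hsol : ∃ x y, P.IsOptimal x y) :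
    P.kkt.Nonempty := by
  obtain ⟨x, y, ⟨hx, hy, hfeas⟩, hopt⟩ := hsol
  let L : Vec n × Vec m →ₗ[ℝ] Vec l := (Matrix.toEuclideanLin P.A) ∘ₗ LinearMap.fst ℝ _ _ +
    (Matrix.toEuclideanLin P.B) ∘ₗ LinearMap.snd ℝ _ _
  have hS : IsPolyhedron {z : Vec n × Vec m | z.1 ∈ P.X ∧ z.2 ∈ P.Y} :=
    (hX.preimage_linear (LinearMap.fst ℝ (Vec n) (Vec m))).inter
      (hY.preimage_linear (LinearMap.snd ℝ (Vec n) (Vec m)))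
  have hF : ConvexOn ℝ Set.univ fun z : Vec n × Vec m => P.f z.1 + P.g z.2 :=
    (hf.comp_linearMap (LinearMap.fst ℝ (Vec n) (Vec m))).add
      (hg.comp_linearMap (LinearMap.snd ℝ (Vec n) (Vec m)))
  obtain ⟨φ, hφ, hφC⟩ := exists_subgradient_nonneg_on hF
    (hS.inter (isPolyhedron_linear_eq L P.b)).convex (p := (x, y)) ⟨⟨hx, hy⟩, hfeas⟩
    (fun z hz => hopt z.1 z.2 ⟨hz.1.1, hz.1.2, hz.2⟩)
  obtain ⟨w, hw⟩ := hS.exists_lagrange_multiplier L (-φ.toLinearMap) (p := (x, y)) ⟨hx, hy⟩ (by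
    intro z hz hLz
    have := hφC z ⟨hz, hLz.trans hfeas⟩
    rw [map_sub] at this
    simpa using this)
  have hwi : ∀ v, inner ℝ (-(InnerProductSpace.toDual ℝ (Vec l)).symm w.toContinuousLinearMap) v =
    -w v := fun v => by simp
  set lam : Vec l := -(InnerProductSpace.toDual ℝ (Vec l)).symm w.toContinuousLinearMap
  obtain ⟨ξ, hξ⟩ := (InnerProductSpace.toDual ℝ (Vec n)).surjective (φ.comp (.inl ℝ _ _))
  obtain ⟨ζ, hζ⟩ := (InnerProductSpace.toDual ℝ (Vec m)).surjective (φ.comp (.inr ℝ _ _))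
  have hξ' : ∀ h, inner ℝ ξ h = φ (h, 0) := fun h => by
    rw [← InnerProductSpace.toDual_apply_apply, hξ]; rfl
  have hζ' : ∀ h, inner ℝ ζ h = φ (0, h) := fun h => by
    rw [← InnerProductSpace.toDual_apply_apply, hζ]; rfl
  refine ⟨stack x y lam, ⟨ξ, fun z => ?_, hx, fun z hz => ?_⟩, ⟨ζ, fun z => ?_, hy, fun z hz => ?_⟩,
    by simp [hfeas]⟩
  · have := hφ (z, y)
    simp only [Prod.mk_sub_mk, sub_self] at this
    simp only [xPart_stack, hξ']
    linarith
  · have h := hw (z, y) ⟨hz, hy⟩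
    have h1 : φ (z, y) = φ (x, y) + φ (z - x, 0) := by rw [← map_add]; simp
    have h2 : L (z, y) = L (x, y) + act P.A (z - x) := by simp [L]; abel
    rw [h2, map_add] at h
    simp only [LinearMap.neg_apply, ContinuousLinearMap.coe_coe, h1] at h
    simp only [xPart_stack, lamPart_stack, inner_neg_left, inner_sub_left, inner_act_transpose, hξ',
      hwi]
    linarith
  · have := hφ (x, z)
    simp only [Prod.mk_sub_mk, sub_self] at this
    simp only [yPart_stack, hζ']
    linarith
  · have h := hw (x, z) ⟨hx, hz⟩
    have h1 : φ (x, z) = φ (x, y) + φ (0, z - y) := by rw [← map_add]; simp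
    have h2 : L (x, z) = L (x, y) + act P.B (z - y) := by simp [L]
    rw [h2, map_add] at h
    simp only [LinearMap.neg_apply, ContinuousLinearMap.coe_coe, h1] at h
    simp only [yPart_stack, lamPart_stack, inner_neg_left, inner_sub_left, inner_act_transpose, hζ',
      hwi]
    linarith

end KKT

/-! ### Quadratic forms -/

section QuadraticForms

variable {ι : Type} [Fintype ι] [DecidableEq ι] {M : Matrix ι ι ℝ}

theorem inner_act_transpose_right {κ : Type} [Fintype κ] [DecidableEq κ] (A : Matrix ι κ ℝ)
    (v : EuclideanSpace ℝ κ) (w : EuclideanSpace ℝ ι) :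
    inner ℝ v (act Aᵀ w) = inner ℝ (act A v) w := by
  rw [real_inner_comm, inner_act_transpose, real_inner_comm]

theorem inner_act_comm (hM : M.IsHermitian) (v w : EuclideanSpace ℝ ι) :
    inner ℝ (act M v) w = inner ℝ v (act M w) := by
  have h := inner_act_transpose M v w
  rwa [← Matrix.conjTranspose_eq_transpose_of_trivial, hM.eq] at h

theorem sqNormM_add (hM : M.IsHermitian) (v w : EuclideanSpace ℝ ι) :
    sqNormM M (v + w) = sqNormM M v + 2 * inner ℝ (act M v) w + sqNormM M w := by
  have h₁ := inner_act_comm hM v w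
  have h₂ := real_inner_comm (act M v) w
  simp only [sqNormM, act, map_add, inner_add_left, inner_add_right] at h₁ h₂ ⊢
  linarith

theorem sqNormM_smul (t : ℝ) (v : EuclideanSpace ℝ ι) :
    sqNormM M (t • v) = t ^ 2 * sqNormM M v := by
  simp only [sqNormM, map_smul, inner_smul_left, inner_smul_right, conj_trivial]
  ring

theorem sqNormM_eq_dotProduct (v : EuclideanSpace ℝ ι) :
    sqNormM M v = star (v : ι → ℝ) ⬝ᵥ (M *ᵥ (v : ι → ℝ)) := by
  simp [sqNormM, EuclideanSpace.inner_eq_star_dotProduct, Matrix.toLpLin_apply, dotProduct_comm]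

theorem sqNormM_pos (hM : M.PosDef) {v : EuclideanSpace ℝ ι} (hv : v ≠ 0) : 0 < sqNormM M v := by
  rw [sqNormM_eq_dotProduct]
  exact hM.dotProduct_mulVec_pos (by simpa using hv)

theorem sqNormM_nonneg (hM : M.PosDef) (v : EuclideanSpace ℝ ι) : 0 ≤ sqNormM M v := by
  rcases eq_or_ne v 0 with rfl | hv
  · simp [sqNormM]
  · exact (sqNormM_pos hM hv).le

theorem posDef_of_sqNormM_pos (hM : M.IsHermitian) (h : ∀ v, v ≠ 0 → 0 < sqNormM M v) :
    M.PosDef :=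
  .of_dotProduct_mulVec_pos hM fun x hx => by
    simpa [sqNormM_eq_dotProduct] using h (WithLp.toLp 2 x) (by simpa using hx)

theorem normM_sq (hM : M.PosDef) (v : EuclideanSpace ℝ ι) : normM M v ^ 2 = sqNormM M v :=
  Real.sq_sqrt (sqNormM_nonneg hM v)

/-- The spectral decomposition of the quadratic form of a symmetric matrix. -/
theorem sqNormM_eq_sum_eigenvalues (hM : M.IsHermitian) (v : EuclideanSpace ℝ ι) :
    sqNormM M v = ∑ i, hM.eigenvalues i * inner ℝ (hM.eigenvectorBasis i) v ^ 2 := by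
  rw [sqNormM, ← hM.eigenvectorBasis.sum_inner_mul_inner]
  refine Finset.sum_congr rfl fun i _ => ?_
  have h : act M (hM.eigenvectorBasis i) = hM.eigenvalues i • hM.eigenvectorBasis i := by
    ext j
    simpa [Matrix.toLpLin_apply] using congrFun (hM.mulVec_eigenvectorBasis i) j
  rw [← inner_act_comm hM, h, inner_smul_left, real_inner_comm, conj_trivial]
  ring

theorem exists_pos_mul_sq_le_sqNormM (hM : M.PosDef) :
    ∃ c > 0, ∀ v : EuclideanSpace ℝ ι, c * ‖v‖ ^ 2 ≤ sqNormM M v := by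
  obtain ⟨c, hc, h⟩ : ∃ c > 0, ∀ i, c ≤ hM.1.eigenvalues i := by
    rcases isEmpty_or_nonempty ι with h | h
    · exact ⟨1, one_pos, fun i => isEmptyElim i⟩
    · obtain ⟨i, hi⟩ := Finite.exists_min hM.1.eigenvalues
      exact ⟨_, hM.eigenvalues_pos i, hi⟩
  refine ⟨c, hc, fun v => ?_⟩
  rw [sqNormM_eq_sum_eigenvalues hM.1, ← hM.1.eigenvectorBasis.sum_sq_inner_right, Finset.mul_sum]
  exact Finset.sum_le_sum fun i _ => mul_le_mul_of_nonneg_right (h i) (sq_nonneg _)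

theorem sqNormM_le_lambdaMax (hM : M.IsHermitian) (v : EuclideanSpace ℝ ι) :
    sqNormM M v ≤ lambdaMax M * ‖v‖ ^ 2 := by
  have hfin : {μ : ℝ | Module.End.HasEigenvalue (Matrix.toLin' M) μ}.Finite :=
    Module.End.finite_hasEigenvalue _
  have h : ∀ i, hM.eigenvalues i ≤ lambdaMax M := fun i => by
    refine le_csSup hfin.bddAbove (Module.End.hasEigenvalue_of_hasEigenvector
      (x := (hM.eigenvectorBasis i : ι → ℝ)) ⟨?_, ?_⟩)
    · rw [Module.End.mem_eigenspace_iff, Matrix.toLin'_apply]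
      exact hM.mulVec_eigenvectorBasis i
    · simpa using hM.eigenvectorBasis.orthonormal.ne_zero i
  rw [sqNormM_eq_sum_eigenvalues hM, ← hM.eigenvectorBasis.sum_sq_inner_right, Finset.mul_sum]
  exact Finset.sum_le_sum fun i _ => mul_le_mul_of_nonneg_right (h i) (sq_nonneg _)

theorem lambdaMax_pos [Nonempty ι] (hM : M.PosDef) : 0 < lambdaMax M := by
  obtain ⟨v, hv⟩ := exists_ne (0 : EuclideanSpace ℝ ι)
  have := (sqNormM_pos hM hv).trans_le (sqNormM_le_lambdaMax hM.1 v)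
  exact pos_of_mul_pos_left this (sq_nonneg _)

end QuadraticForms

theorem act_sub {ι κ : Type} [Fintype ι] [Fintype κ] [DecidableEq κ] (M : Matrix ι κ ℝ)
    (v w : EuclideanSpace ℝ κ) : act M (v - w) = act M v - act M w :=
  map_sub _ v w

theorem exists_norm_act_le {ι κ : Type} [Fintype ι] [Fintype κ] [DecidableEq κ]
    (M : Matrix ι κ ℝ) : ∃ K ≥ 0, ∀ v : EuclideanSpace ℝ κ, ‖act M v‖ ≤ K * ‖v‖ :=
  ⟨_, norm_nonneg _, (Matrix.toEuclideanLin M).toContinuousLinearMap.le_opNorm⟩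

section Blocks

variable {n m l : ℕ}

@[simp] theorem xPart_sub (u v : Pt n m l) : xPart (u - v) = xPart u - xPart v := rfl
@[simp] theorem yPart_sub (u v : Pt n m l) : yPart (u - v) = yPart u - yPart v := rfl
@[simp] theorem lamPart_sub (u v : Pt n m l) : lamPart (u - v) = lamPart u - lamPart v := rfl

theorem inner_eq_parts (u v : Pt n m l) : inner ℝ u v =
    inner ℝ (xPart u) (xPart v) + inner ℝ (yPart u) (yPart v) +
      inner ℝ (lamPart u) (lamPart v) := by
  simp [PiLp.inner_apply, xPart, yPart, lamPart, Fintype.sum_sum_type, add_assoc]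

theorem norm_sq_eq_parts (u : Pt n m l) :
    ‖u‖ ^ 2 = ‖xPart u‖ ^ 2 + ‖yPart u‖ ^ 2 + ‖lamPart u‖ ^ 2 := by
  simp only [← real_inner_self_eq_norm_sq, inner_eq_parts]

theorem eq_zero_of_parts {u : Pt n m l} (hx : xPart u = 0) (hy : yPart u = 0)
    (hl : lamPart u = 0) : u = 0 := by
  have := norm_sq_eq_parts u
  rw [hx, hy, hl] at this
  simpa using this

variable (P : Problem n m l) (G : Matrix (Fin n) (Fin n) ℝ) (α β : ℝ)

theorem Problem.sqNormM_Gam (v : Pt n m l) : sqNormM (P.Gam G α β) v =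
    sqNormM G (xPart v) + β / α * ‖act P.B (yPart v)‖ ^ 2 +
      2 * ((1 - α) / α) * inner ℝ (act P.B (yPart v)) (lamPart v) +
      1 / (α * β) * ‖lamPart v‖ ^ 2 := by
  have hx : xPart (act (P.Gam G α β) v) = act G (xPart v) := by
    ext i
    simp [xPart, Problem.Gam, Matrix.toLpLin_apply, Matrix.mulVec, dotProduct, Matrix.fromBlocks,
      Fintype.sum_sum_type]
  have hy : yPart (act (P.Gam G α β) v) = (β / α) • act P.Bᵀ (act P.B (yPart v)) +
      ((1 - α) / α) • act P.Bᵀ (lamPart v) := by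
    have h : yPart (act (P.Gam G α β) v) = act ((β / α) • (P.Bᵀ * P.B)) (yPart v) +
        act (((1 - α) / α) • P.Bᵀ) (lamPart v) := by
      ext i
      simp [yPart, lamPart, Problem.Gam, Matrix.toLpLin_apply, Matrix.mulVec, dotProduct,
        Matrix.fromBlocks, Fintype.sum_sum_type]
    rw [h]
    ext i
    simp [Matrix.toLpLin_apply, Matrix.smul_mulVec]
  have hl : lamPart (act (P.Gam G α β) v) = ((1 - α) / α) • act P.B (yPart v) +
      (1 / (α * β)) • lamPart v := by
    have h : lamPart (act (P.Gam G α β) v) = act (((1 - α) / α) • P.B) (yPart v) +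
        act ((1 / (α * β)) • (1 : Matrix (Fin l) (Fin l) ℝ)) (lamPart v) := by
      ext i
      simp [yPart, lamPart, Problem.Gam, Matrix.toLpLin_apply, Matrix.mulVec, dotProduct,
        Matrix.fromBlocks, Fintype.sum_sum_type]
    rw [h]
    ext i
    simp [Matrix.toLpLin_apply, Matrix.smul_mulVec]
  rw [sqNormM, inner_eq_parts, hx, hy, hl, sqNormM]
  simp only [inner_add_right, inner_smul_right, inner_act_transpose_right,
    real_inner_self_eq_norm_sq]
  rw [real_inner_comm (act P.B (yPart v)) (lamPart v)]
  ring

theorem Problem.sqNormM_Gam0 (v : Pt n m l) : sqNormM (P.Gam0 G α β) v =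
    sqNormM G (xPart v) + β * ((2 - α) / α ^ 2) * ‖act P.B (yPart v)‖ ^ 2 +
      (2 - α) / (β * α ^ 2) * ‖lamPart v‖ ^ 2 := by
  have hx : xPart (act (P.Gam0 G α β) v) = act G (xPart v) := by
    ext i
    simp [xPart, Problem.Gam0, Matrix.toLpLin_apply, Matrix.mulVec, dotProduct, Matrix.fromBlocks,
      Fintype.sum_sum_type]
  have hy : yPart (act (P.Gam0 G α β) v) =
      (β * ((2 - α) / α ^ 2)) • act P.Bᵀ (act P.B (yPart v)) := by
    have h : yPart (act (P.Gam0 G α β) v) =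
        act ((β * ((2 - α) / α ^ 2)) • (P.Bᵀ * P.B)) (yPart v) := by
      ext i
      simp [yPart, Problem.Gam0, Matrix.toLpLin_apply, Matrix.mulVec, dotProduct,
        Matrix.fromBlocks, Fintype.sum_sum_type]
    rw [h]
    ext i
    simp [Matrix.toLpLin_apply, Matrix.smul_mulVec]
  have hl : lamPart (act (P.Gam0 G α β) v) = ((2 - α) / (β * α ^ 2)) • lamPart v := by
    have h : lamPart (act (P.Gam0 G α β) v) =
        act (((2 - α) / (β * α ^ 2)) • (1 : Matrix (Fin l) (Fin l) ℝ)) (lamPart v) := by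
      ext i
      simp [lamPart, Problem.Gam0, Matrix.toLpLin_apply, Matrix.mulVec, dotProduct,
        Matrix.fromBlocks, Fintype.sum_sum_type]
    rw [h]
    ext i
    simp [Matrix.toLpLin_apply, Matrix.smul_mulVec]
  rw [sqNormM, inner_eq_parts, hx, hy, hl, sqNormM]
  simp only [inner_smul_right, inner_act_transpose_right,
    real_inner_self_eq_norm_sq]

end Blocks

section Gam

variable {n m l : ℕ} (P : Problem n m l) {G : Matrix (Fin n) (Fin n) ℝ} {α β : ℝ}

theorem eq_zero_of_act_eq_zero {B : Matrix (Fin l) (Fin m) ℝ} (hB : B.rank = m) {y : Vec m}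
    (h : act B y = 0) : y = 0 := by
  have h₁ := LinearMap.finrank_range_add_finrank_ker B.mulVecLin
  rw [← Matrix.rank, hB, Module.finrank_fin_fun] at h₁
  have h₂ : LinearMap.ker B.mulVecLin = ⊥ := Submodule.finrank_eq_zero.1 (by omega)
  have h₃ : B *ᵥ (y : Fin m → ℝ) = 0 := by
    simpa [Matrix.toLpLin_apply] using h
  have h₄ : (y : Fin m → ℝ) = 0 := by
    rw [← LinearMap.mem_ker.trans (by rfl : B.mulVecLin y = 0 ↔ B *ᵥ (y : Fin m → ℝ) = 0), h₂] at h₃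
    simpa using h₃
  simpa using h₄

theorem Problem.posDef_Gam (hB : P.B.rank = m) (hα : α ∈ Set.Ioo (0 : ℝ) 2) (hβ : 0 < β)
    (hG : G.PosDef) : (P.Gam G α β).PosDef := by
  obtain ⟨hα0, hα2⟩ := hα
  refine posDef_of_sqNormM_pos ?_ fun v hv => ?_
  · refine .fromBlocks hG.1 (by simp) (.fromBlocks ?_ ?_ ?_)
    · simp [Matrix.IsHermitian, Matrix.conjTranspose_eq_transpose_of_trivial]
    · simp [Matrix.conjTranspose_eq_transpose_of_trivial]
    · simp [Matrix.IsHermitian, Matrix.conjTranspose_eq_transpose_of_trivial]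
  rw [P.sqNormM_Gam]
  set p := ‖act P.B (yPart v)‖
  set q := ‖lamPart v‖
  set s := inner ℝ (act P.B (yPart v)) (lamPart v)
  have hs : |s| ≤ p * q := abs_real_inner_le_norm _ _
  have hρ : |1 - α| < 1 := by rw [abs_lt]; constructor <;> linarith
  -- the form in `(B y, lam)` is definite because its normalized off-diagonal entry is `1 - α`
  have hlow : (1 - |1 - α|) * ((β * p) ^ 2 + q ^ 2) / (α * β) ≤
      β / α * p ^ 2 + 2 * ((1 - α) / α) * s + 1 / (α * β) * q ^ 2 := by
    have h1 : -(|1 - α| * (p * q)) ≤ (1 - α) * s := by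
      have := neg_abs_le ((1 - α) * s)
      rw [abs_mul] at this
      linarith [mul_le_mul_of_nonneg_left hs (abs_nonneg (1 - α))]
    rw [div_le_iff₀ (by positivity)]
    have h2 : (β / α * p ^ 2 + 2 * ((1 - α) / α) * s + 1 / (α * β) * q ^ 2) * (α * β) =
        (β * p) ^ 2 + 2 * β * ((1 - α) * s) + q ^ 2 := by field_simp
    rw [h2]
    nlinarith [mul_le_mul_of_nonneg_left h1 hβ.le,
      mul_nonneg (abs_nonneg (1 - α)) (sq_nonneg (β * p - q))]
  have hGx := sqNormM_nonneg hG (xPart v)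
  have hc : 0 < 1 - |1 - α| := by linarith
  by_cases hx : xPart v = 0
  · suffices 0 < (β * p) ^ 2 + q ^ 2 by
      have : 0 < (1 - |1 - α|) * ((β * p) ^ 2 + q ^ 2) / (α * β) := by positivity
      linarith
    by_cases hy : p = 0
    · have hl : q ≠ 0 := fun hl => hv (eq_zero_of_parts hx
        (eq_zero_of_act_eq_zero hB (norm_eq_zero.1 hy)) (norm_eq_zero.1 hl))
      positivity
    · positivity
  · have h1 := sqNormM_pos hG hx
    have : 0 ≤ (1 - |1 - α|) * ((β * p) ^ 2 + q ^ 2) / (α * β) := by positivity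
    linarith

theorem Problem.normM_Gam0_sq (hα : α ∈ Set.Ioo (0 : ℝ) 2) (hβ : 0 < β) (hG : G.PosDef)
    (v : Pt n m l) : normM (P.Gam0 G α β) v ^ 2 = sqNormM (P.Gam0 G α β) v := by
  refine Real.sq_sqrt ?_
  rw [P.sqNormM_Gam0]
  have := sqNormM_nonneg hG (xPart v)
  have : 0 < 2 - α := by linarith [hα.2]
  have := hα.1
  positivity

end Gam

/-! ### One step of the method -/

section Step

variable {n m l : ℕ} {P : Problem n m l} {G : Matrix (Fin n) (Fin n) ℝ} {α β : ℝ} {u u' : Pt n m l}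

/-- The primal residual after a step, in terms of the changes of the multiplier and of `B y`. -/
theorem Problem.IsStep.residual_eq (h : P.IsStep G α β u u') (hα : α ≠ 0) (hβ : β ≠ 0) :
    act P.A (xPart u') + act P.B (yPart u') - P.b =
      (1 / (α * β)) • (lamPart u - lamPart u') +
        ((1 - α) / α) • act P.B (yPart u - yPart u') := by
  rw [h.2.2, act_sub]
  match_scalars <;> field_simp <;> ring

/-- The optimality condition of the `x`-subproblem, written at the new multiplier. -/
theorem Problem.IsStep.exists_mem_subdiff_x (h : P.IsStep G α β u u')
    (hf : ConvexOn ℝ Set.univ P.f) (hX : Convex ℝ P.X) (hα : α ≠ 0) (hβ : β ≠ 0)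
    (hG : G.PosDef) :
    ∃ ξ ∈ subdiff P.f (xPart u'), -(ξ - act P.Aᵀ (lamPart u') +
      (act P.Aᵀ (((1 - α) / α) • (lamPart u - lamPart u') +
        (β / α) • act P.B (yPart u - yPart u')) + act G (xPart u' - xPart u))) ∈
      normalCone P.X (xPart u') := by
  have hres := h.residual_eq hα hβ
  obtain ⟨ξ, hξ, hN⟩ := exists_mem_subdiff_of_isArgmin_add hf hX
    (q := fun x => -inner ℝ x (act P.Aᵀ (lamPart u))
      + β / 2 * ‖act P.A x + act P.B (yPart u) - P.b‖ ^ 2 + 1 / 2 * normM G (x - xPart u) ^ 2)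
    (p := xPart u')
    (v := act P.Aᵀ (-lamPart u + β • (act P.A (xPart u') + act P.B (yPart u) - P.b)) +
      act G (xPart u' - xPart u))
    (fun z => β / 2 * ‖act P.A z‖ ^ 2 + 1 / 2 * sqNormM G z) (by
      intro z t
      have e1 : act P.A (xPart u' + t • z) + act P.B (yPart u) - P.b =
          (act P.A (xPart u') + act P.B (yPart u) - P.b) + t • act P.A z := by
        simp only [act, map_add, map_smul]
        module
      have e2 : xPart u' + t • z - xPart u = (xPart u' - xPart u) + t • z := by abel
      rw [e1, e2, normM_sq hG, normM_sq hG, sqNormM_add hG.1, sqNormM_smul, norm_add_sq_real,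
        norm_smul, mul_pow, Real.norm_eq_abs, sq_abs]
      simp only [inner_add_left, inner_smul_left, inner_smul_right,
        inner_act_transpose, inner_act_transpose_right, conj_trivial, inner_neg_left]
      rw [real_inner_comm (act P.A z) (lamPart u)]
      ring)
    (by
      convert h.1 using 2
      ring)
  refine ⟨ξ, hξ, ?_⟩
  convert hN using 2
  have e : ((1 - α) / α) • (lamPart u - lamPart u') + (β / α) • act P.B (yPart u - yPart u') =
      lamPart u' - lamPart u + β • (act P.A (xPart u') + act P.B (yPart u) - P.b) := by
    have e1 : act P.A (xPart u') + act P.B (yPart u) - P.b =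
        (act P.A (xPart u') + act P.B (yPart u') - P.b) + act P.B (yPart u - yPart u') := by
      rw [act_sub]; abel
    rw [e1, hres]
    match_scalars <;> field_simp <;> ring
  rw [e]
  simp only [act, map_add, map_sub, map_neg]
  abel

/-- The optimality condition of the `y`-subproblem involves only the new multiplier. -/
theorem Problem.IsStep.exists_mem_subdiff_y (h : P.IsStep G α β u u')
    (hg : ConvexOn ℝ Set.univ P.g) (hY : Convex ℝ P.Y) :
    ∃ ζ ∈ subdiff P.g (yPart u'), -(ζ - act P.Bᵀ (lamPart u')) ∈ normalCone P.Y (yPart u') := by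
  obtain ⟨-, h2, h3⟩ := h
  set c := α • act P.A (xPart u') + (1 - α) • (P.b - act P.B (yPart u))
  obtain ⟨ζ, hζ, hN⟩ := exists_mem_subdiff_of_isArgmin_add hg hY
    (q := fun y => -inner ℝ y (act P.Bᵀ (lamPart u)) + β / 2 * ‖c + act P.B y - P.b‖ ^ 2)
    (p := yPart u') (v := -act P.Bᵀ (lamPart u'))
    (fun z => β / 2 * ‖act P.B z‖ ^ 2) (by
      intro z t
      have e1 : c + act P.B (yPart u' + t • z) - P.b =
          (c + act P.B (yPart u') - P.b) + t • act P.B z := by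
        simp only [act, map_add, map_smul]
        abel
      rw [e1, h3, norm_add_sq_real, norm_smul, mul_pow, Real.norm_eq_abs, sq_abs]
      simp only [inner_add_left, inner_sub_left, inner_smul_left, inner_smul_right,
        inner_act_transpose, inner_act_transpose_right, conj_trivial, inner_neg_left]
      rw [real_inner_comm (act P.B z) (lamPart u)]
      ring)
    (by
      convert h2 using 2
      ring)
  exact ⟨ζ, hζ, by simpa [sub_eq_add_neg] using hN⟩

/-- Two `y`-blocks that are optimal at their own multipliers are monotonically related. -/
theorem inner_lam_sub_nonneg {v w : Pt n m l}
    (hv : ∃ ζ ∈ subdiff P.g (yPart v), -(ζ - act P.Bᵀ (lamPart v)) ∈ normalCone P.Y (yPart v))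
    (hw : ∃ ζ ∈ subdiff P.g (yPart w), -(ζ - act P.Bᵀ (lamPart w)) ∈ normalCone P.Y (yPart w)) :
    0 ≤ inner ℝ (lamPart v - lamPart w) (act P.B (yPart v - yPart w)) := by
  obtain ⟨ζ, hζ, hN⟩ := hv
  obtain ⟨η, hη, hM⟩ := hw
  have h1 := inner_sub_nonneg_of_mem_subdiff hζ hη
  have h2 := inner_sub_nonneg_of_mem_normalCone hN hM
  have e : -(ζ - act P.Bᵀ (lamPart v)) - -(η - act P.Bᵀ (lamPart w)) =
      act P.Bᵀ (lamPart v - lamPart w) - (ζ - η) := by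
    rw [act_sub]; abel
  rw [e, inner_sub_left, inner_act_transpose] at h2
  linarith

/-- The contraction inequality with respect to a KKT point `w`. The hypothesis `hmono` holds as soon
as `u` itself was produced by a step. -/
theorem Problem.IsStep.sqNormM_sub_kkt_le (h : P.IsStep G α β u u')
    (hf : ConvexOn ℝ Set.univ P.f) (hg : ConvexOn ℝ Set.univ P.g)
    (hX : Convex ℝ P.X) (hY : Convex ℝ P.Y) (hα : α ∈ Set.Ioo (0 : ℝ) 2) (hβ : 0 < β)
    (hG : G.PosDef)
    (hmono : 0 ≤ inner ℝ (lamPart u - lamPart u') (act P.B (yPart u - yPart u')))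
    {w : Pt n m l} (hw : w ∈ P.kkt) :
    sqNormM (P.Gam G α β) (u' - w) + sqNormM (P.Gam0 G α β) (u - u') ≤
      sqNormM (P.Gam G α β) (u - w) := by
  obtain ⟨hα0, hα2⟩ := hα
  have hres := h.residual_eq hα0.ne' hβ.ne'
  obtain ⟨ξ, hξ, hN⟩ := h.exists_mem_subdiff_x hf hX hα0.ne' hβ.ne' hG
  have hY2 := inner_lam_sub_nonneg (h.exists_mem_subdiff_y hg hY) hw.2.1
  obtain ⟨⟨η, hη, hM⟩, -, hfeas⟩ := hw
  have h1 := inner_sub_nonneg_of_mem_subdiff hξ hη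
  have h2 := inner_sub_nonneg_of_mem_normalCone hN hM
  set a := lamPart u - lamPart u' with ha
  set d := act P.B (yPart u - yPart u') with hd
  set e := act P.B (yPart u' - yPart w) with he
  set μ := lamPart u' - lamPart w with hμ
  set x := xPart u' - xPart w with hx
  set g := xPart u - xPart u' with hg'
  have hAx : act P.A x = (1 / (α * β)) • a + ((1 - α) / α) • d - e := by
    rw [← hres, he, hx, act_sub, act_sub, ← sub_zero (_ - P.b - _), ← hfeas]
    abel
  -- monotonicity for the `x`-block
  have hX2 : inner ℝ (((1 - α) / α) • a + (β / α) • d) (act P.A x) - inner ℝ (act G g) x ≤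
      inner ℝ μ (act P.A x) := by
    have e1 : -(ξ - act P.Aᵀ (lamPart u') + (act P.Aᵀ (((1 - α) / α) • a + (β / α) • d) +
        act G (xPart u' - xPart u))) - -(η - act P.Aᵀ (lamPart w)) =
        act P.Aᵀ μ - act P.Aᵀ (((1 - α) / α) • a + (β / α) • d) + act G g - (ξ - η) := by
      have e3 : act G g = -act G (xPart u' - xPart u) := by rw [← map_neg, neg_sub]
      rw [hμ, e3, act_sub P.Aᵀ (lamPart u')]
      abel
    rw [e1, inner_sub_left, inner_add_left, inner_sub_left, inner_act_transpose,
      inner_act_transpose] at h2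
    linarith
  have e4 : xPart u - xPart w = g + x := by rw [hg', hx]; abel
  have e5 : act P.B (yPart u - yPart w) = d + e := by rw [hd, he, ← map_add]; congr 1; abel
  have e6 : lamPart u - lamPart w = a + μ := by rw [ha, hμ]; abel
  simp only [P.sqNormM_Gam, P.sqNormM_Gam0, xPart_sub, yPart_sub, lamPart_sub]
  rw [e4, e5, e6, sqNormM_add hG.1, ← ha, ← hd, ← he, ← hμ, ← hx, ← hg']
  rw [hAx] at hX2
  simp only [← real_inner_self_eq_norm_sq, inner_add_left, inner_add_right, inner_sub_right,
    inner_smul_left, inner_smul_right, conj_trivial] at hX2 ⊢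
  simp only [real_inner_comm d a, real_inner_comm d e, real_inner_comm e a, real_inner_comm a μ,
    real_inner_comm d μ, real_inner_comm e μ] at *
  have hmono' := mul_nonneg
    (div_nonneg (by linarith : 0 ≤ 2 * (2 - α)) (sq_nonneg α)) hmono
  rw [← sub_nonneg]
  rw [← sub_nonneg] at hX2
  have hsum := add_nonneg (add_nonneg (mul_nonneg zero_le_two hX2) (mul_nonneg zero_le_two hY2))
    hmono'
  refine hsum.trans_eq ?_
  field_simp
  ring

end Step

variable {n m l : ℕ} {P : Problem n m l} {G : Matrix (Fin n) (Fin n) ℝ} {α β : ℝ}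

/-! ### The residual of a step -/

theorem Problem.err_nonempty (hf : ConvexOn ℝ Set.univ P.f) (hg : ConvexOn ℝ Set.univ P.g)
    (hX : IsPolyhedron P.X) (hY : IsPolyhedron P.Y) (hXne : P.X.Nonempty) (hYne : P.Y.Nonempty)
    (u : Pt n m l) (γ : ℝ) : (P.err u γ).Nonempty := by
  obtain ⟨ξ, hξ⟩ := subdiff_nonempty hf (xPart u)
  obtain ⟨ζ, hζ⟩ := subdiff_nonempty hg (yPart u)
  obtain ⟨p, hp⟩ := exists_isProj hX hXne (xPart u - γ • (ξ - act P.Aᵀ (lamPart u)))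
  obtain ⟨q, hq⟩ := exists_isProj hY hYne (yPart u - γ • (ζ - act P.Bᵀ (lamPart u)))
  exact ⟨stack (xPart u - p) (yPart u - q)
    (γ • (act P.A (xPart u) + act P.B (yPart u) - P.b)),
    ⟨ξ, hξ, p, hp, rfl⟩, ⟨ζ, hζ, q, hq, rfl⟩, rfl⟩

/-- After a step the `y`-block of the residual vanishes, and the other two are bounded by the
changes of `x`, `B y` and `lam`. -/
theorem Problem.exists_infDist_err_sq_le (hf : ConvexOn ℝ Set.univ P.f)
    (hg : ConvexOn ℝ Set.univ P.g) (hX : IsPolyhedron P.X) (hY : IsPolyhedron P.Y)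
    (hXne : P.X.Nonempty) (hα : 0 < α) (hβ : 0 < β) (hG : G.PosDef) :
    ∃ K : ℝ, 0 < K ∧ ∀ u u' : Pt n m l, P.IsStep G α β u u' →
      Metric.infDist 0 (P.err u' 1) ^ 2 ≤ K * (‖lamPart u - lamPart u'‖ ^ 2 +
        ‖act P.B (yPart u - yPart u')‖ ^ 2 + ‖xPart u - xPart u'‖ ^ 2) := by
  obtain ⟨KA, hKA, hA⟩ := exists_norm_act_le P.Aᵀ
  obtain ⟨KG, hKG, hKG'⟩ := exists_norm_act_le G
  obtain ⟨k₁, h1, hk₁⟩ : ∃ k₁ : ℝ, 0 ≤ k₁ ∧ |(1 - α) / α| = k₁ := ⟨_, abs_nonneg _, rfl⟩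
  obtain ⟨k₂, h2, hk₂⟩ : ∃ k₂ : ℝ, 0 < k₂ ∧ |β / α| = k₂ := ⟨_, by positivity, rfl⟩
  obtain ⟨k₃, h3, hk₃⟩ : ∃ k₃ : ℝ, 0 < k₃ ∧ |1 / (α * β)| = k₃ := ⟨_, by positivity, rfl⟩
  obtain ⟨k, hk⟩ : ∃ k, k = KA * (k₁ + k₂) + KG + (k₃ + k₁) := ⟨_, rfl⟩
  have hkpos : 0 < k := by rw [hk]; positivity
  refine ⟨6 * k ^ 2, by positivity, fun u u' h => ?_⟩
  have hres := h.residual_eq hα.ne' hβ.ne'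
  obtain ⟨ξ, hξ, hN⟩ := h.exists_mem_subdiff_x hf hX.convex hα.ne' hβ.ne' hG
  obtain ⟨ζ, hζ, hM⟩ := h.exists_mem_subdiff_y hg hY.convex
  rw [norm_sub_rev (xPart u)]
  generalize lamPart u - lamPart u' = a at *
  generalize act P.B (yPart u - yPart u') = d at *
  generalize hg' : xPart u' - xPart u = g at *
  obtain ⟨T, hT⟩ : ∃ T, T = ‖a‖ + ‖d‖ + ‖g‖ := ⟨_, rfl⟩
  have ha0 := norm_nonneg a
  have hd0 := norm_nonneg d
  have hg0 := norm_nonneg g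
  have hTa : ‖a‖ ≤ T := by linarith
  have hTd : ‖d‖ ≤ T := by linarith
  have hTg : ‖g‖ ≤ T := by linarith
  have hT0 : 0 ≤ T := by linarith
  have hcomb : ∀ s t : ℝ, ‖s • a + t • d‖ ≤ (|s| + |t|) * T := fun s t => by
    refine (norm_add_le _ _).trans ?_
    rw [norm_smul, norm_smul, Real.norm_eq_abs, Real.norm_eq_abs, add_mul]
    gcongr
  have hδT : ‖act P.Aᵀ (((1 - α) / α) • a + (β / α) • d) + act G g‖ ≤ k * T := by
    have e := hcomb ((1 - α) / α) (β / α)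
    rw [hk₁, hk₂] at e
    calc _ ≤ KA * ((k₁ + k₂) * T) + KG * T := (norm_add_le _ _).trans
          (add_le_add ((hA _).trans (by gcongr)) ((hKG' g).trans (by gcongr)))
      _ = (KA * (k₁ + k₂) + KG) * T := by ring
      _ ≤ k * T := by
        gcongr
        rw [hk]
        linarith
  have hrT : ‖act P.A (xPart u') + act P.B (yPart u') - P.b‖ ≤ k * T := by
    have e := hcomb (1 / (α * β)) ((1 - α) / α)
    rw [hk₁, hk₃, ← hres] at e
    refine e.trans ?_
    gcongr
    rw [hk]
    have : 0 ≤ KA * (k₁ + k₂) := by positivity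
    linarith
  obtain ⟨p, hp⟩ := exists_isProj hX hXne (xPart u' - (1 : ℝ) • (ξ - act P.Aᵀ (lamPart u')))
  have hxp : ‖xPart u' - p‖ ≤ k * T := by
    refine (norm_sub_le_of_isProj hX.convex (z := xPart u' - (ξ - act P.Aᵀ (lamPart u') +
      (act P.Aᵀ (((1 - α) / α) • a + (β / α) • d) + act G g))) ?_ hp).trans ?_
    · rw [isProj_iff_mem_normalCone hX.convex, sub_sub_cancel_left]
      exact hN
    · rwa [one_smul, sub_sub_sub_cancel_left, sub_add_cancel_left, norm_neg]
  have hyproj : IsProj P.Y (yPart u' - (1 : ℝ) • (ζ - act P.Bᵀ (lamPart u'))) (yPart u') := by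
    rw [isProj_iff_mem_normalCone hY.convex, sub_sub_cancel_left, one_smul]
    exact hM
  have hmem : stack (xPart u' - p) 0 (act P.A (xPart u') + act P.B (yPart u') - P.b) ∈
      P.err u' 1 :=
    ⟨⟨ξ, hξ, p, hp, rfl⟩, ⟨ζ, hζ, _, hyproj, (sub_self _).symm⟩, (one_smul _ _).symm⟩
  have e1 := Metric.infDist_le_dist_of_mem (x := (0 : Pt n m l)) hmem
  rw [dist_zero_left] at e1
  have e2 : T ^ 2 ≤ 3 * (‖a‖ ^ 2 + ‖d‖ ^ 2 + ‖g‖ ^ 2) := by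
    rw [hT]
    nlinarith only [sq_nonneg (‖a‖ - ‖d‖), sq_nonneg (‖a‖ - ‖g‖), sq_nonneg (‖d‖ - ‖g‖)]
  calc Metric.infDist 0 (P.err u' 1) ^ 2
      ≤ ‖stack (xPart u' - p) 0 (act P.A (xPart u') + act P.B (yPart u') - P.b)‖ ^ 2 :=
        pow_le_pow_left₀ Metric.infDist_nonneg e1 2
    _ = ‖xPart u' - p‖ ^ 2 + ‖act P.A (xPart u') + act P.B (yPart u') - P.b‖ ^ 2 := by
        rw [norm_sq_eq_parts]
        simp
    _ ≤ (k * T) ^ 2 + (k * T) ^ 2 := by gcongr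
    _ = 2 * k ^ 2 * T ^ 2 := by ring
    _ ≤ 2 * k ^ 2 * (3 * (‖a‖ ^ 2 + ‖d‖ ^ 2 + ‖g‖ ^ 2)) := by gcongr
    _ = _ := by ring

theorem Problem.exists_isResidualConst (hf : ConvexOn ℝ Set.univ P.f)
    (hg : ConvexOn ℝ Set.univ P.g) (hX : IsPolyhedron P.X) (hY : IsPolyhedron P.Y)
    (hXne : P.X.Nonempty) (hα : α ∈ Set.Ioo (0 : ℝ) 2) (hβ : 0 < β) (hG : G.PosDef) :
    ∃ σ : ℝ, 0 < σ ∧ P.IsResidualConst G α β σ := by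
  obtain ⟨K, hK, hle⟩ := P.exists_infDist_err_sq_le hf hg hX hY hXne hα.1 hβ hG
  obtain ⟨cG, hcG, hcG'⟩ := exists_pos_mul_sq_le_sqNormM hG
  have hα0 := hα.1
  have hα2 : 0 < 2 - α := by linarith [hα.2]
  obtain ⟨c, hc, hc₁, hc₂, hc₃⟩ : ∃ c > 0, c ≤ cG ∧ c ≤ β * ((2 - α) / α ^ 2) ∧
      c ≤ (2 - α) / (β * α ^ 2) :=
    ⟨min cG (min (β * ((2 - α) / α ^ 2)) ((2 - α) / (β * α ^ 2))),
      lt_min hcG (lt_min (by positivity) (by positivity)), min_le_left _ _,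
      (min_le_right _ _).trans (min_le_left _ _), (min_le_right _ _).trans (min_le_right _ _)⟩
  refine ⟨c / K, by positivity, fun u u' h => ?_⟩
  rw [P.normM_Gam0_sq hα hβ hG, P.sqNormM_Gam0, xPart_sub, yPart_sub, lamPart_sub]
  have e₁ := mul_le_mul_of_nonneg_right hc₁ (sq_nonneg ‖xPart u - xPart u'‖)
  have e₂ := mul_le_mul_of_nonneg_right hc₂ (sq_nonneg ‖act P.B (yPart u - yPart u')‖)
  have e₃ := mul_le_mul_of_nonneg_right hc₃ (sq_nonneg ‖lamPart u - lamPart u'‖)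
  have e₄ := hcG' (xPart u - xPart u')
  calc c / K * Metric.infDist 0 (P.err u' 1) ^ 2
      ≤ c / K * (K * (‖lamPart u - lamPart u'‖ ^ 2 + ‖act P.B (yPart u - yPart u')‖ ^ 2 +
          ‖xPart u - xPart u'‖ ^ 2)) := mul_le_mul_of_nonneg_left (hle u u' h) (by positivity)
    _ = c * (‖lamPart u - lamPart u'‖ ^ 2 + ‖act P.B (yPart u - yPart u')‖ ^ 2 +
          ‖xPart u - xPart u'‖ ^ 2) := by field_simp
    _ ≤ _ := by linarith

/-! ### The error bound on bounded sets -/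

/-- `xPart` as a linear map. -/
noncomputable def xPartₗ : Pt n m l →ₗ[ℝ] Vec n where
  toFun := xPart
  map_add' _ _ := rfl
  map_smul' _ _ := rfl

/-- `yPart` as a linear map. -/
noncomputable def yPartₗ : Pt n m l →ₗ[ℝ] Vec m where
  toFun := yPart
  map_add' _ _ := rfl
  map_smul' _ _ := rfl

/-- `lamPart` as a linear map. -/
noncomputable def lamPartₗ : Pt n m l →ₗ[ℝ] Vec l where
  toFun := lamPart
  map_add' _ _ := rfl
  map_smul' _ _ := rfl

/-- The residual `x - P_K[x - (ξ - M lam)]` with the projection eliminated in favour of the normal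
cone. -/
theorem exists_isProj_iff {k : ℕ} {h : Vec k → ℝ} {K : Set (Vec k)} (hK : Convex ℝ K)
    {x r s : Vec k} :
    (∃ ξ ∈ subdiff h x, ∃ p, IsProj K (x - (1 : ℝ) • (ξ - s)) p ∧ r = x - p) ↔
      ∃ ξ, ξ ∈ subdiff h x ∧ r - ξ + s ∈ normalCone K (x - r) := by
  refine exists_congr fun ξ => and_congr_right fun _ => ?_
  simp only [isProj_iff_mem_normalCone hK]
  constructor
  · rintro ⟨p, hp, rfl⟩
    convert hp using 2 <;> module
  · intro hr
    exact ⟨x - r, by convert hr using 1; module, by abel⟩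

theorem isPolyhedralUnion_residual {E : Type} [AddCommGroup E] [Module ℝ E] {k : ℕ}
    {h : Vec k → ℝ} {K : Set (Vec k)} (hK : IsPolyhedron K) (hh : IsPiecewiseLinear (subdiff h))
    (x r s : E →ₗ[ℝ] Vec k) :
    IsPolyhedralUnion {z | ∃ ξ ∈ subdiff h (x z), ∃ p,
      IsProj K (x z - (1 : ℝ) • (ξ - s z)) p ∧ r z = x z - p} := by
  simp only [exists_isProj_iff hK.convex]
  let z : E × Vec k →ₗ[ℝ] E := LinearMap.fst ℝ E (Vec k)
  let ξ : E × Vec k →ₗ[ℝ] Vec k := LinearMap.snd ℝ E (Vec k)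
  exact ((hh.isPolyhedralUnion.preimage_linear ((x ∘ₗ z).prod ξ)).inter
    (hK.isPolyhedralUnion_normalCone.preimage_linear
      ((x ∘ₗ z - r ∘ₗ z).prod (r ∘ₗ z - ξ + s ∘ₗ z)))).exists_snd

theorem Problem.isPolyhedralUnion_err (hX : IsPolyhedron P.X) (hY : IsPolyhedron P.Y)
    (hdf : IsPiecewiseLinear (subdiff P.f)) (hdg : IsPiecewiseLinear (subdiff P.g)) :
    IsPolyhedralUnion {q : Pt n m l × Pt n m l | q.2 ∈ P.err q.1 1} := by
  let u : Pt n m l × Pt n m l →ₗ[ℝ] Pt n m l := LinearMap.fst ℝ _ _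
  let w : Pt n m l × Pt n m l →ₗ[ℝ] Pt n m l := LinearMap.snd ℝ _ _
  have hx := isPolyhedralUnion_residual hX hdf (xPartₗ ∘ₗ u) (xPartₗ ∘ₗ w)
    (Matrix.toEuclideanLin P.Aᵀ ∘ₗ lamPartₗ ∘ₗ u)
  have hy := isPolyhedralUnion_residual hY hdg (yPartₗ ∘ₗ u) (yPartₗ ∘ₗ w)
    (Matrix.toEuclideanLin P.Bᵀ ∘ₗ lamPartₗ ∘ₗ u)
  have hl := isPolyhedron_linear_eq (lamPartₗ ∘ₗ w - (Matrix.toEuclideanLin P.A ∘ₗ xPartₗ ∘ₗ u +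
    Matrix.toEuclideanLin P.B ∘ₗ yPartₗ ∘ₗ u)) (-P.b)
  convert hx.inter (hy.inter (.of_isPolyhedron hl)) using 1
  ext q
  refine and_congr Iff.rfl (and_congr Iff.rfl ?_)
  change lamPart q.2 = (1 : ℝ) • (act P.A (xPart q.1) + act P.B (yPart q.1) - P.b) ↔
    lamPart q.2 - (act P.A (xPart q.1) + act P.B (yPart q.1)) = -P.b
  rw [one_smul, sub_eq_iff_eq_add, neg_add_eq_sub]

theorem Problem.zero_mem_err_iff (hX : Convex ℝ P.X) (hY : Convex ℝ P.Y) {u : Pt n m l} :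
    0 ∈ P.err u 1 ↔ u ∈ P.kkt := by
  have e : ∀ {k : ℕ} (ξ s : Vec k), 0 - ξ + s = -(ξ - s) := fun ξ s => by abel
  have hx : xPart (0 : Pt n m l) = 0 := rfl
  have hy : yPart (0 : Pt n m l) = 0 := rfl
  have hl : lamPart (0 : Pt n m l) = 0 := rfl
  rw [Problem.err, Problem.kkt, Set.mem_ofPred_eq, Set.mem_ofPred_eq, exists_isProj_iff hX,
    exists_isProj_iff hY, hx, hy, hl]
  simp only [e, sub_zero, one_smul, eq_comm (a := (0 : Vec l))]

/-- Close to the zero set this is the local error bound for polyhedral relations; away from it the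
residual is bounded below, while the distance to the KKT points is bounded above. -/
theorem Problem.exists_isErrorBoundConst (hf : ConvexOn ℝ Set.univ P.f)
    (hg : ConvexOn ℝ Set.univ P.g) (hX : IsPolyhedron P.X) (hY : IsPolyhedron P.Y)
    (hsol : ∃ x y, P.IsOptimal x y)
    (hdf : IsPiecewiseLinear (subdiff P.f)) (hdg : IsPiecewiseLinear (subdiff P.g))
    {U : Set (Pt n m l)} (hU : Bornology.IsBounded U) :
    ∃ ψ : ℝ, 0 < ψ ∧ P.IsErrorBoundConst U ψ := by
  obtain ⟨w, hw⟩ := P.kkt_nonempty hf hg hX hY hsol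
  obtain ⟨x₀, y₀, ⟨hx₀, hy₀, -⟩, -⟩ := hsol
  obtain ⟨ε, hε, C, hC, hEB⟩ := (P.isPolyhedralUnion_err hX hY hdf hdg).hasErrorBound
  obtain ⟨R, hR⟩ := hU.subset_closedBall w
  refine ⟨C + |R| / ε + 1, by positivity, fun u hu => ?_⟩
  set r := Metric.infDist 0 (P.err u 1) with hr
  have hr0 : 0 ≤ r := Metric.infDist_nonneg
  have hne := P.err_nonempty hf hg hX hY ⟨x₀, hx₀⟩ ⟨y₀, hy₀⟩ u 1
  have hRε : 0 ≤ |R| / ε := by positivity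
  rcases lt_or_ge r ε with hlt | hge
  · suffices h : Metric.infDist u P.kkt ≤ C * r by
      have := mul_nonneg hRε hr0
      linarith
    have hcont : Continuous fun ρ : ℝ => C * ρ := by fun_prop
    refine ge_of_tendsto (hcont.continuousWithinAt (s := Set.Ioi r) (x := r)).tendsto ?_
    filter_upwards [Ioo_mem_nhdsGT hlt] with ρ hρ
    obtain ⟨v, hv, hvr⟩ := (Metric.infDist_lt_iff hne).1 hρ.1
    rw [dist_zero_left] at hvr
    obtain ⟨u', hu', hd⟩ := hEB u v hv (hvr.trans hρ.2)
    calc Metric.infDist u P.kkt ≤ dist u u' :=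
          Metric.infDist_le_dist_of_mem ((P.zero_mem_err_iff hX.convex hY.convex).1 hu')
      _ ≤ C * ‖v‖ := by rwa [dist_eq_norm]
      _ ≤ C * ρ := by gcongr
  · calc Metric.infDist u P.kkt ≤ dist u w := Metric.infDist_le_dist_of_mem hw
      _ ≤ |R| := (hR hu).trans (le_abs_self R)
      _ = |R| / ε * ε := by field_simp
      _ ≤ |R| / ε * r := by gcongr
      _ ≤ (C + |R| / ε + 1) * r := by
        have := mul_nonneg hC hr0
        linarith

/-! ### Boundedness and linear convergence -/

section DistM

variable {ι : Type} [Fintype ι] [DecidableEq ι] {M : Matrix ι ι ℝ} {S : Set (EuclideanSpace ℝ ι)}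
  {u : EuclideanSpace ℝ ι}

theorem distM_nonneg : 0 ≤ distM M u S :=
  Real.sInf_nonneg (by rintro _ ⟨w, -, rfl⟩; exact Real.sqrt_nonneg _)

theorem distM_le_normM {w : EuclideanSpace ℝ ι} (hw : w ∈ S) : distM M u S ≤ normM M (u - w) :=
  csInf_le ⟨0, by rintro _ ⟨w, -, rfl⟩; exact Real.sqrt_nonneg _⟩ ⟨w, hw, rfl⟩

theorem le_distM_sq (hS : S.Nonempty) {c : ℝ} (h : ∀ w ∈ S, c ≤ normM M (u - w) ^ 2) :
    c ≤ distM M u S ^ 2 := by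
  rw [← Real.sqrt_le_left distM_nonneg]
  refine le_csInf (hS.image _) ?_
  rintro _ ⟨w, hw, rfl⟩
  exact (Real.sqrt_le_left (Real.sqrt_nonneg _)).2 (h w hw)

theorem distM_sq_le_lambdaMax [Nonempty ι] (hM : M.PosDef) (hS : S.Nonempty) :
    distM M u S ^ 2 ≤ lambdaMax M * Metric.infDist u S ^ 2 := by
  have hpos := lambdaMax_pos hM
  rw [← div_le_iff₀' hpos, ← Real.sqrt_le_left Metric.infDist_nonneg, Metric.le_infDist hS]
  intro w hw
  rw [Real.sqrt_le_left dist_nonneg, div_le_iff₀' hpos, dist_eq_norm]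
  calc distM M u S ^ 2 ≤ normM M (u - w) ^ 2 := pow_le_pow_left₀ distM_nonneg (distM_le_normM hw) 2
    _ = sqNormM M (u - w) := normM_sq hM _
    _ ≤ _ := sqNormM_le_lambdaMax hM.1 _

end DistM

theorem Problem.IsPGADMM.isBounded {u : ℕ → Pt n m l} {w : Pt n m l}
    (hΓ : (P.Gam G α β).PosDef)
    (hstep : ∀ k, 1 ≤ k → sqNormM (P.Gam G α β) (u (k + 1) - w) ≤
      sqNormM (P.Gam G α β) (u k - w)) :
    Bornology.IsBounded (Set.range u) := by
  obtain ⟨c, hc, hc'⟩ := exists_pos_mul_sq_le_sqNormM hΓ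
  have hle : ∀ k, 1 ≤ k → sqNormM (P.Gam G α β) (u k - w) ≤ sqNormM (P.Gam G α β) (u 1 - w) := by
    intro k hk
    induction k, hk using Nat.le_induction with
    | base => exact le_rfl
    | succ k hk ih => exact (hstep k hk).trans ih
  refine ((Metric.isBounded_closedBall (x := w)
    (r := √(sqNormM (P.Gam G α β) (u 1 - w) / c))).insert (u 0)).subset ?_
  rintro _ ⟨k, rfl⟩
  rcases Nat.eq_zero_or_pos k with rfl | hk
  · exact Set.mem_insert _ _
  · refine Set.mem_insert_of_mem _ ?_
    rw [Metric.mem_closedBall, dist_eq_norm]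
    refine Real.le_sqrt_of_sq_le ?_
    rw [le_div_iff₀' hc]
    exact (hc' _).trans (hle k hk)

end PGADMM

theorem theorem3p1 {n m l : ℕ} (hdim : 0 < n + m + l) (P : PGADMM.Problem n m l)
    (hf : ConvexOn ℝ Set.univ P.f) (hg : ConvexOn ℝ Set.univ P.g)
    (hX : PGADMM.IsPolyhedron P.X) (hY : PGADMM.IsPolyhedron P.Y)
    (hsol : ∃ x y, P.IsOptimal x y)
    (hB : P.B.rank = m)
    (hdf : PGADMM.IsPiecewiseLinear (PGADMM.subdiff P.f))
    (hdg : PGADMM.IsPiecewiseLinear (PGADMM.subdiff P.g))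
    (α β : ℝ) (hα : α ∈ Set.Ioo (0 : ℝ) 2) (hβ : 0 < β)
    (G : Matrix (Fin n) (Fin n) ℝ) (hG : G.PosDef) :
    P.kkt.Nonempty ∧
    -- the constants exist
    (∃ σ : ℝ, 0 < σ ∧ P.IsResidualConst G α β σ) ∧
    (∀ U : Set (PGADMM.Pt n m l), Bornology.IsBounded U →
      ∃ ψ : ℝ, 0 < ψ ∧ P.IsErrorBoundConst U ψ) ∧
    -- the iterates are bounded, and all such constants give the rate
    ∀ u : ℕ → PGADMM.Pt n m l, P.IsPGADMM G α β u →
      Bornology.IsBounded (Set.range u) ∧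
      ∀ σ ψ : ℝ, 0 < σ → 0 < ψ → P.IsResidualConst G α β σ →
        P.IsErrorBoundConst (Set.range u) ψ →
        0 < P.rate G α β σ ψ ∧ P.rate G α β σ ψ < 1 ∧
        ∀ k : ℕ, 1 ≤ k →
          PGADMM.distM (P.Gam G α β) (u (k + 1)) P.kkt ^ 2 ≤
            P.rate G α β σ ψ * PGADMM.distM (P.Gam G α β) (u k) P.kkt ^ 2 := by
  have hne := P.kkt_nonempty hf hg hX hY hsol
  have hXne : P.X.Nonempty := by
    obtain ⟨x, y, ⟨hx, -⟩, -⟩ := hsol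
    exact ⟨x, hx⟩
  have hΓ := P.posDef_Gam hB hα hβ hG
  have : Nonempty (Fin n ⊕ (Fin m ⊕ Fin l)) := by
    rw [← Fintype.card_pos_iff]
    simp only [Fintype.card_sum, Fintype.card_fin]
    omega
  refine ⟨hne, P.exists_isResidualConst hf hg hX hY hXne hα hβ hG,
    fun U hU => P.exists_isErrorBoundConst hf hg hX hY hsol hdf hdg hU, fun u hu => ?_⟩
  have hfejer : ∀ k, 1 ≤ k → ∀ w ∈ P.kkt, PGADMM.sqNormM (P.Gam G α β) (u (k + 1) - w) +
      PGADMM.normM (P.Gam0 G α β) (u k - u (k + 1)) ^ 2 ≤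
        PGADMM.sqNormM (P.Gam G α β) (u k - w) := by
    intro k hk w hw
    obtain ⟨j, rfl⟩ := Nat.exists_eq_add_of_le' hk
    rw [P.normM_Gam0_sq hα hβ hG]
    exact (hu (j + 1)).sqNormM_sub_kkt_le hf hg hX.convex hY.convex hα hβ hG
      (PGADMM.inner_lam_sub_nonneg ((hu j).exists_mem_subdiff_y hg hY.convex)
        ((hu (j + 1)).exists_mem_subdiff_y hg hY.convex)) hw
  refine ⟨?_, fun σ ψ hσ hψ hres herr => ?_⟩
  · obtain ⟨w, hw⟩ := hne
    exact PGADMM.Problem.IsPGADMM.isBounded hΓ (w := w) fun k hk => by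
      linarith [hfejer k hk w hw, sq_nonneg (PGADMM.normM (P.Gam0 G α β) (u k - u (k + 1)))]
  have hlam := PGADMM.lambdaMax_pos hΓ
  set L := PGADMM.lambdaMax (P.Gam G α β) with hL
  have hq : 0 < σ / (ψ ^ 2 * L) := by positivity
  have hrate : P.rate G α β σ ψ = 1 / (1 + σ / (ψ ^ 2 * L)) := rfl
  refine ⟨by rw [hrate]; positivity, ?_, fun k hk => ?_⟩
  · rw [hrate, div_lt_one (by positivity)]
    linarith
  have hdec : PGADMM.distM (P.Gam G α β) (u (k + 1)) P.kkt ^ 2 +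
      PGADMM.normM (P.Gam0 G α β) (u k - u (k + 1)) ^ 2 ≤
        PGADMM.distM (P.Gam G α β) (u k) P.kkt ^ 2 := by
    refine PGADMM.le_distM_sq hne fun w hw => ?_
    have h1 := pow_le_pow_left₀ PGADMM.distM_nonneg
      (PGADMM.distM_le_normM (M := P.Gam G α β) (u := u (k + 1)) hw) 2
    have h2 := hfejer k hk w hw
    rw [PGADMM.normM_sq hΓ] at h1 ⊢
    linarith
  have hprog : σ / (ψ ^ 2 * L) * PGADMM.distM (P.Gam G α β) (u (k + 1)) P.kkt ^ 2 ≤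
      PGADMM.normM (P.Gam0 G α β) (u k - u (k + 1)) ^ 2 := by
    refine le_trans ?_ (hres _ _ (hu k))
    have h1 := PGADMM.distM_sq_le_lambdaMax (u := u (k + 1)) hΓ hne
    have h2 := pow_le_pow_left₀ Metric.infDist_nonneg (herr _ ⟨k + 1, rfl⟩) 2
    calc σ / (ψ ^ 2 * L) * PGADMM.distM (P.Gam G α β) (u (k + 1)) P.kkt ^ 2
        ≤ σ / (ψ ^ 2 * L) * (L * (ψ * Metric.infDist 0 (P.err (u (k + 1)) 1)) ^ 2) := by
          gcongr
          exact h1.trans (by gcongr)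
      _ = σ * Metric.infDist 0 (P.err (u (k + 1)) 1) ^ 2 := by field_simp
  rw [hrate, div_mul_eq_mul_div, one_mul, le_div_iff₀ (by positivity)]
  linarith
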